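/- Let $F$ be a field of characteristic zero, $m\ge 2$ an integer, and $w=w_1w_2\cdots$ an infinite word in the alphabet $\{0,1\}$ which is periodic ($w_{i+T}=w_i$ for all $i\ge 1$ and some fixed $T\ge 1$) or Sturmian (for every $n\ge 1$ it has exactly $n+1$ distinct subwords of length $n$), with slope $\alpha=\lim_{n\to\infty}\frac{w_1+\cdots+w_n}{n}$. Put $k_i=m+w_i$, and let $A=A(m,w)$ be the (nonassociative) $F$-algebra with basis $\{a,b\}\cup\{z_j^{(i)} : i\ge 1,\ 1\le j\le k_i\}$ and multiplication $$z_j^{(i)}a=z_{j+1}^{(i)}\ (1\le j<k_i),\qquad z_{k_i}^{(i)}b=z_1^{(i+1)}\qquad (i\ge 1),$$ all other products of basis elements being zero. Let $P_n$ be the space of multilinear polynomials in $x_1,\dots,x_n$ in the absolutely free (nonassociative, nonunital) $F$-algebra, let $\mathrm{Id}(A)$ be the set of polynomial identities of $A$, and put $c_n(A)=\dim P_n/(P_n\cap \mathrm{Id}(A))$. For a $\mathbb{Z}_2$-grading $A=A_0\oplus A_1$, let $P_{k,l}$ be the space of polynomials multilinear in $k$ even variables $x_1,\dots,x_k$ and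 $l$ odd variables $y_1,\dots,y_l$, let $\mathrm{Id}^{gr}(A)$ be the set of graded identities of $A$ (the polynomials in even and odd variables vanishing under all substitutions of elements of $A_0$ for the even and of $A_1$ for the odd variables), and put $$c_{k,l}(A)=\dim P_{k,l}/(P_{k,l}\cap \mathrm{Id}^{gr}(A)),\qquad c_n^{gr}(A)=\sum_{k=0}^n\binom nk c_{k,n-k}(A).$$ **Theorem.** Suppose that $A=A_0\oplus A_1$ is a $\mathbb{Z}_2$-grading of $A=A(m,w)$ such that $a,z_1^{(1)}\in A_0$ and $b\in A_1$. Then both limits $\exp^{gr}(A)=\lim_{n\to\infty}\sqrt[n]{c_n^{gr}(A)}$ and $\exp(A)=\lim_{n\to\infty}\sqrt[n]{c_n(A)}$ exist, and $$\exp^{gr}(A)=\exp(A)=\Phi\left(\frac1{m+\alpha}\right),\qquad\text{where}\quad \Phi(x)=\frac{1}{x^{x}(1-x)^{1-x}}.$$ -/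

import Mathlib

open Filter Topology

noncomputable section

/-! ### Polynomial identities of nonassociative algebras -/

/-- The multiset of letters of a nonassociative monomial. -/
def FreeMagma.letters {V : Type*} : FreeMagma V → Multiset V
  | FreeMagma.of x => {x}
  | FreeMagma.mul s t => FreeMagma.letters s + FreeMagma.letters t

/-- The subspace of the free nonassociative algebra `F{V}` of polynomials that are multilinear in
the variables from the finite set `S`: the span of the monomials in which each variable from `S`
occurs exactly once and no other variable occurs. -/
def multilinearPolys (F : Type*) [Field F] {V : Type*} (S : Finset V) :
    Submodule F (FreeNonUnitalNonAssocAlgebra F V) :=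
  Submodule.span F
    {f | ∃ t : FreeMagma V, t.letters = S.val ∧ f = MonoidAlgebra.single t (1 : F)}

section Identities

variable (F : Type*) [Field F] (A : Type*) [NonUnitalNonAssocRing A] [Module F A]
  [IsScalarTower F A A] [SMulCommClass F A A]

/-- The polynomials of `F{V}` that vanish under all substitutions from the set `E`. -/
def vanishingPolys {V : Type*} (E : Set (V → A)) :
    Submodule F (FreeNonUnitalNonAssocAlgebra F V) where
  carrier := {f | ∀ φ ∈ E, FreeNonUnitalNonAssocAlgebra.lift F φ f = 0}
  add_mem' := fun hf hg φ hφ => by rw [map_add, hf φ hφ, hg φ hφ, add_zero]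
  zero_mem' := fun _ _ => map_zero _
  smul_mem' := fun c _ hf φ hφ => by rw [map_smul, hf φ hφ, smul_zero]

/-- `Id(A)`, in the variables `x₀, x₁, …`. -/
def identities : Submodule F (FreeNonUnitalNonAssocAlgebra F ℕ) :=
  vanishingPolys F A Set.univ

/-- The codimension `c_n(A) = dim P_n / (P_n ∩ Id(A))`. -/
def codim (n : ℕ) : ℕ :=
  Module.finrank F
    (multilinearPolys F (Finset.range n) ⧸
      (identities F A).comap (multilinearPolys F (Finset.range n)).subtype)

/-- The PI-exponent `exp(A) = lim c_n(A)^{1/n}` exists and equals `e`. -/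
def HasPIExponent (e : ℝ) : Prop :=
  Tendsto (fun n : ℕ => (codim F A n : ℝ) ^ (1 / (n : ℝ))) atTop (𝓝 e)

variable {F A} (𝒜 : ZMod 2 → Submodule F A)

/-- `Id^{gr}(A)`, for `A` with homogeneous components `𝒜 0` and `𝒜 1`; the variables `Sum.inl i` are
the even ones, the variables `Sum.inr i` are the odd ones. -/
def gradedIdentities : Submodule F (FreeNonUnitalNonAssocAlgebra F (ℕ ⊕ ℕ)) :=
  vanishingPolys F A {φ | (∀ i, φ (Sum.inl i) ∈ 𝒜 0) ∧ (∀ i, φ (Sum.inr i) ∈ 𝒜 1)}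

/-- The space `P_{k,l}` of polynomials multilinear in `k` even and `l` odd variables. -/
def gradedMultilinearPolys (F : Type*) [Field F] (k l : ℕ) :
    Submodule F (FreeNonUnitalNonAssocAlgebra F (ℕ ⊕ ℕ)) :=
  multilinearPolys F ((Finset.range k).disjSum (Finset.range l))

/-- The partial codimension `c_{k,l}(A) = dim P_{k,l} / (P_{k,l} ∩ Id^{gr}(A))`. -/
def partialCodim (k l : ℕ) : ℕ :=
  Module.finrank F
    (gradedMultilinearPolys F k l ⧸
      (gradedIdentities 𝒜).comap (gradedMultilinearPolys F k l).subtype)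

/-- The graded codimension `c_n^{gr}(A) = ∑_{k=0}^n (n choose k) c_{k,n-k}(A)`. -/
def gradedCodim (n : ℕ) : ℕ :=
  ∑ k ∈ Finset.range (n + 1), n.choose k * partialCodim 𝒜 k (n - k)

/-- The graded PI-exponent `exp^{gr}(A) = lim c_n^{gr}(A)^{1/n}` exists and equals `e`. -/
def HasGradedPIExponent (e : ℝ) : Prop :=
  Tendsto (fun n : ℕ => (gradedCodim 𝒜 n : ℝ) ^ (1 / (n : ℝ))) atTop (𝓝 e)

end Identities

/-! ### The algebras `A(K)` and `A(m, w)` -/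

/-- The basis `a`, `b`, `z_j^{(i)}` of `A(K)`. Both indices start at `0` here, so that `z i j` stands
for `z_{j+1}^{(i+1)}`, and `K i` stands for `k_{i+1}`. -/
inductive WordBasis (K : ℕ → ℕ) : Type
  | a : WordBasis K
  | b : WordBasis K
  | z (i : ℕ) (j : Fin (K i)) : WordBasis K

/-- The vector space with basis `WordBasis K`. It becomes the algebra `A(K)` below. -/
def WordAlgebra (F : Type*) [Field F] (K : ℕ → ℕ) : Type _ := WordBasis K →₀ F

namespace WordAlgebra

variable (F : Type*) [Field F] (K : ℕ → ℕ)

instance instAddCommGroup : AddCommGroup (WordAlgebra F K) := inferInstanceAs (AddCommGroup (WordBasis K →₀ F))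

instance : Module F (WordAlgebra F K) := inferInstanceAs (Module F (WordBasis K →₀ F))

/-- A basis vector, as an element of `A(K)`. -/
def ofBasis (u : WordBasis K) : WordAlgebra F K := (Finsupp.single u (1 : F) : WordBasis K →₀ F)

/-- The element `a`. -/
def a : WordAlgebra F K := ofBasis F K WordBasis.a

/-- The element `b`. -/
def b : WordAlgebra F K := ofBasis F K WordBasis.b

/-- The basis element `z_{j+1}^{(i+1)}` if `j < K i`, and `0` otherwise. -/
def z (i j : ℕ) : WordAlgebra F K :=
  if h : j < K i then ofBasis F K (WordBasis.z i ⟨j, h⟩) else 0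

/-- The multiplication table: `z_j^{(i)} a = z_{j+1}^{(i)}` for `j < k_i`,
`z_{k_i}^{(i)} b = z_1^{(i+1)}`, and all other products of basis elements are zero.
(In the first line of the code, `z F K i (j + 1) = 0` when `j` is the last index.) -/
def mulBasis : WordBasis K → WordBasis K → WordAlgebra F K
  | WordBasis.z i j, WordBasis.a => z F K i (j + 1)
  | WordBasis.z i j, WordBasis.b => if (j : ℕ) + 1 = K i then z F K (i + 1) 0 else 0
  | _, _ => 0

/-- The multiplication, as the bilinear extension of the multiplication table. -/
def mulMap : WordAlgebra F K →ₗ[F] WordAlgebra F K →ₗ[F] WordAlgebra F K :=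
  show (WordBasis K →₀ F) →ₗ[F] (WordBasis K →₀ F) →ₗ[F] WordAlgebra F K from
    Finsupp.linearCombination F fun u => Finsupp.linearCombination F fun v => mulBasis F K u v

instance : NonUnitalNonAssocRing (WordAlgebra F K) :=
  { instAddCommGroup F K with
    mul := fun x y => mulMap F K x y
    left_distrib := fun x y y' => map_add (mulMap F K x) y y'
    right_distrib := fun x x' y => LinearMap.map_add₂ (mulMap F K) x x' y
    zero_mul := fun y => LinearMap.map_zero₂ (mulMap F K) y
    mul_zero := fun x => map_zero (mulMap F K x) }

instance : IsScalarTower F (WordAlgebra F K) (WordAlgebra F K) :=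
  ⟨fun c x y => LinearMap.map_smul₂ (mulMap F K) c x y⟩

instance : SMulCommClass F (WordAlgebra F K) (WordAlgebra F K) :=
  ⟨fun c x y => ((mulMap F K x).map_smul c y).symm⟩

end WordAlgebra

/-- The sequence `k_i = m + w_i` attached to `m` and to a binary word `w`. -/
def wordSeq (m : ℕ) (w : ℕ → Fin 2) (i : ℕ) : ℕ := m + (w i : ℕ)

/-! ### Infinite binary words -/

/-- `Comp_w(n)`: the number of distinct subwords (factors) of length `n` of `w`. -/
def wordComplexity (w : ℕ → Fin 2) (n : ℕ) : ℕ :=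
  Set.ncard {u : Fin n → Fin 2 | ∃ i : ℕ, ∀ j : Fin n, u j = w (i + j)}

/-- Sturmian words. -/
def IsSturmian (w : ℕ → Fin 2) : Prop := ∀ n : ℕ, 1 ≤ n → wordComplexity w n = n + 1

/-- Periodic words. -/
def IsPeriodicWord (w : ℕ → Fin 2) : Prop := ∃ T : ℕ, 0 < T ∧ Function.Periodic w T

/-- The slope `π(w) = lim h(w_1 ⋯ w_n) / n` exists and equals `α`. -/
def HasSlope (w : ℕ → Fin 2) (α : ℝ) : Prop :=
  Tendsto (fun n : ℕ => (∑ i ∈ Finset.range n, ((w i : ℕ) : ℝ)) / (n : ℝ)) atTop (𝓝 α)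

/-- `Φ(x) = x^{-x} (1-x)^{-(1-x)}`. -/
def entropyPhi (x : ℝ) : ℝ := 1 / (x ^ x * (1 - x) ^ (1 - x))

end

/-!
The products `z * a` and `z * b` either move a basis element `z` one step along the chain of all
the `z`'s or vanish, and every other product of basis elements is zero. So under a substitution of
basis elements a monomial of degree `n` vanishes unless it is left normed, its first letter takes a
value `z`, and the remaining letters spell, in terms of `a` and `b`, the word of length `n - 1` that
is read along the chain from that `z`. Hence the value of a multilinear polynomial is determined by
the variable sent to a `z`, the set of variables sent to `b`, and the word read
(`WordAlgebra.finrank_le_card_triples`). Conversely, for a fixed starting point, different sets of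
variables sent to `b` are distinguished by monomials (`WordAlgebra.card_le_finrank`). With `r(u)`
the number of letters `b` in `u`, this gives
`(n-1).choose (r(u₀)) ≤ c_n ≤ n * ∑ u, (n-1).choose (r(u))`, where `u` runs over the words of length
`n - 1` read along the chain, and `u₀` is the one read from the first `z`. In the graded case the
homogeneous components are spanned by basis elements, so that the set of variables sent to `b` is
forced, and `c_{k,l}` is at most `n` times the number of words `u`, and zero unless `l` is `r(u)` or
`r(u) + 1` for some `u`; the factor `n.choose k` then restores the same binomial coefficients.

It remains to see that there are only polynomially many words `u` and that `r(u) / n` tends to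
`1 / (m + α)` uniformly in `u`. A word `u` is determined by an offset and a factor of `w`, and
periodic and Sturmian words have at most linear complexity. A factor with `r` letters `b` has length
`m r + h + O(1)`, where `h` is the number of ones in a window of length `r` of `w`, and up to a
bounded error `h` does not depend on the window (`exists_uniform_bound`): this is clear for periodic
words, and for Sturmian words it is the theorem of Morse and Hedlund that they are balanced
(`IsSturmian.balanced`). The limits then follow from the entropy bounds for binomial coefficients
(`tendsto_rpow_of_choose_bounds`).
-/

/-! ### Balance of Sturmian words and uniform frequencies -/

/-- The number of ones among the `n` letters of `w` starting at position `i`. -/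
def windowWeight (w : ℕ → Fin 2) (i n : ℕ) : ℕ := ∑ s ∈ Finset.range n, (w (i + s) : ℕ)

/-- The words of length `n` that occur in `w` at the positions `i` and `j` coincide. -/
def AgreeOn (w : ℕ → Fin 2) (n i j : ℕ) : Prop := ∀ k < n, w (i + k) = w (j + k)

/-- The set of factors of length `n`. -/
def factorSet (w : ℕ → Fin 2) (n : ℕ) : Set (Fin n → Fin 2) :=
  {u | ∃ i : ℕ, ∀ j : Fin n, u j = w (i + j)}

/-- The factor of length `n` at position `i`. -/
def factorAt (w : ℕ → Fin 2) (n i : ℕ) : Fin n → Fin 2 := fun k => w (i + k)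

section Words

variable {w : ℕ → Fin 2}

lemma factorAt_eq_iff {n i j : ℕ} : factorAt w n i = factorAt w n j ↔ AgreeOn w n i j := by
  constructor
  · intro h k hk
    exact congrFun h ⟨k, hk⟩
  · intro h
    funext k
    exact h k k.2

lemma factorSet_eq_range (w : ℕ → Fin 2) (n : ℕ) : factorSet w n = Set.range (factorAt w n) := by
  ext u
  constructor
  · rintro ⟨i, hi⟩
    exact ⟨i, funext fun k => (hi k).symm⟩
  · rintro ⟨i, rfl⟩
    exact ⟨i, fun k => rfl⟩

lemma wordComplexity_eq (w : ℕ → Fin 2) (n : ℕ) : wordComplexity w n = (factorSet w n).ncard := rfl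

lemma AgreeOn.symm {n i j : ℕ} (h : AgreeOn w n i j) : AgreeOn w n j i :=
  fun k hk => (h k hk).symm

lemma AgreeOn.trans {n i j l : ℕ} (h : AgreeOn w n i j) (h' : AgreeOn w n j l) :
    AgreeOn w n i l := fun k hk => (h k hk).trans (h' k hk)

lemma AgreeOn.succ {n i j : ℕ} (h : AgreeOn w n i j) (h' : w (i + n) = w (j + n)) :
    AgreeOn w (n + 1) i j := by
  intro k hk
  rcases Nat.lt_succ_iff_lt_or_eq.mp hk with hk | rfl
  · exact h k hk
  · exact h'

lemma AgreeOn.tail {n i j : ℕ} (h : AgreeOn w (n + 1) i j) : AgreeOn w n (i + 1) (j + 1) := by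
  intro k hk
  have := h (k + 1) (by omega)
  rwa [show i + 1 + k = i + (k + 1) by omega, show j + 1 + k = j + (k + 1) by omega]

/-- A Sturmian word has at most one right special factor of each length: passing from length `M`
to length `M + 1` the complexity increases by one only. -/
lemma IsSturmian.rightSpecial_unique (hw : IsSturmian w) {M x y x' y' : ℕ}
    (h : AgreeOn w M x y) (hne : w (x + M) ≠ w (y + M))
    (h' : AgreeOn w M x' y') (hne' : w (x' + M) ≠ w (y' + M)) : AgreeOn w M x x' := by
  rcases Nat.eq_zero_or_pos M with rfl | hM
  · intro k hk
    omega
  by_contra hcon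
  have c1 : (factorSet w M).ncard = M + 1 := hw M hM
  have c2 : (factorSet w (M + 1)).ncard = M + 1 + 1 := hw (M + 1) (by omega)
  -- one extension of each factor, and a second one for each of the two right special factors
  choose pos hpos using fun u : factorSet w M => u.2
  let ext : factorSet w M → (Fin (M + 1) → Fin 2) := fun u => factorAt w (M + 1) (pos u)
  have hextinj : Function.Injective ext := by
    intro u v huv
    apply Subtype.ext
    funext k
    rw [hpos u k, hpos v k]
    exact (factorAt_eq_iff.mp huv) k (by omega)
  have other : ∀ p q : ℕ, AgreeOn w M p q → w (p + M) ≠ w (q + M) →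
      ∃ r, AgreeOn w M p r ∧ factorAt w (M + 1) r ∉ Set.range ext := by
    intro p q hpq hn
    let u : factorSet w M := ⟨factorAt w M p, p, fun _ => rfl⟩
    have hu : AgreeOn w M p (pos u) := fun k hk => hpos u ⟨k, hk⟩
    have key : ∀ r, AgreeOn w M p r → w (r + M) ≠ w (pos u + M) →
        factorAt w (M + 1) r ∉ Set.range ext := by
      rintro r hr hrn ⟨v, hv⟩
      have hv' := factorAt_eq_iff.mp hv
      have : v = u := by
        apply Subtype.ext
        funext k
        rw [hpos v k]
        exact (hv' k (by omega)).trans (hr k k.2).symm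
      subst this
      exact hrn (hv' M (by omega)).symm
    by_cases hp : w (p + M) = w (pos u + M)
    · exact ⟨q, hpq, key q hpq (fun h => hn (hp.trans h.symm))⟩
    · exact ⟨p, fun _ _ => rfl, key p (fun _ _ => rfl) hp⟩
  obtain ⟨r, hr, hr'⟩ := other x y h hne
  obtain ⟨s, hs, hs'⟩ := other x' y' h' hne'
  have hrs : factorAt w (M + 1) r ≠ factorAt w (M + 1) s := by
    intro hrs
    apply hcon
    have := factorAt_eq_iff.mp hrs
    exact fun k hk => (hr k hk).trans ((this k (by omega)).trans (hs k hk).symm)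
  have hsub : insert (factorAt w (M + 1) r) (insert (factorAt w (M + 1) s) (Set.range ext))
      ⊆ factorSet w (M + 1) := by
    rintro v (rfl | rfl | ⟨u, rfl⟩) <;> exact ⟨_, fun _ => rfl⟩
  have hcard := Set.ncard_le_ncard hsub (Set.toFinite _)
  rw [Set.ncard_insert_of_notMem (by
      rintro (h | h)
      · exact hrs h
      · exact hr' h) (Set.toFinite _), Set.ncard_insert_of_notMem hs' (Set.toFinite _),
    Set.ncard_range_of_injective hextinj, Nat.card_coe_set_eq] at hcard
  omega

lemma factorSet_subset_of_eventually_periodic {s τ : ℕ} (hτ : 0 < τ)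
    (h : ∀ x, s ≤ x → w (x + τ) = w x) (n : ℕ) :
    factorSet w n ⊆ factorAt w n '' (Finset.range (s + τ) : Set ℕ) := by
  rw [factorSet_eq_range]
  rintro _ ⟨i, rfl⟩
  induction i using Nat.strong_induction_on with
  | _ i ih =>
    by_cases hi : i < s + τ
    · exact ⟨i, by simpa using hi, rfl⟩
    · have : factorAt w n i = factorAt w n (i - τ) := by
        rw [factorAt_eq_iff]
        intro k _
        rw [← h (i - τ + k) (by omega)]
        congr 1
        omega
      rw [this]
      exact ih _ (by omega)

lemma wordComplexity_le_of_eventually_periodic {s τ : ℕ} (hτ : 0 < τ)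
    (h : ∀ x, s ≤ x → w (x + τ) = w x) (n : ℕ) : wordComplexity w n ≤ s + τ := by
  rw [wordComplexity_eq]
  calc (factorSet w n).ncard
      ≤ (factorAt w n '' (Finset.range (s + τ) : Set ℕ)).ncard :=
        Set.ncard_le_ncard (factorSet_subset_of_eventually_periodic hτ h n) (Set.toFinite _)
    _ ≤ (Finset.range (s + τ) : Set ℕ).ncard := Set.ncard_image_le (Finset.finite_toSet _)
    _ = s + τ := by rw [Set.ncard_coe_finset, Finset.card_range]

lemma IsSturmian.not_eventually_periodic (hw : IsSturmian w) {s τ : ℕ} (hτ : 0 < τ)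
    (h : ∀ x, s ≤ x → w (x + τ) = w x) : False := by
  have h1 := wordComplexity_le_of_eventually_periodic hτ h (s + τ)
  have h2 := hw (s + τ) (by omega)
  omega

/-- The heart of the balance property. Suppose that `w` contains `c u c` at `P` and `d u d` at `Q`,
where `u` is a palindrome of length `N - 1` and `c ≠ d`, and that `c u` is not right special. None
of the `N + 1` factors of length `N` starting at `P, …, P + N` equals `d u`, so two of them
coincide; as none of them is right special either, `w` is eventually periodic. -/
lemma IsSturmian.false_of_palindrome (hw : IsSturmian w) {N P Q : ℕ} (hN : 1 ≤ N)
    (hcd : w P ≠ w Q) (hP : w (P + N) = w P) (hQ : w (Q + N) = w Q)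
    (hPQ : ∀ k, 0 < k → k < N → w (P + k) = w (Q + k))
    (hpal : ∀ k, 0 < k → k < N → w (P + k) = w (P + (N - k)))
    (hns : ∀ y, AgreeOn w N P y → w (P + N) = w (y + N)) : False := by
  have avoid : ∀ t ≤ N, ¬ AgreeOn w N (P + t) Q := by
    intro t ht hag
    have h0 := hag 0 (by omega)
    simp only [Nat.add_zero] at h0
    rcases Nat.eq_zero_or_pos t with rfl | htpos
    · exact hcd h0
    rcases Nat.lt_or_ge t N with hlt | hge
    · have h1 := hag (N - t) (by omega)
      rw [show P + t + (N - t) = P + N by omega, hP, ← hPQ _ (by omega) (by omega),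
        ← hpal t htpos hlt, h0] at h1
      exact hcd h1
    · obtain rfl : t = N := le_antisymm ht hge
      exact hcd (hP.symm.trans h0)
  have nrs : ∀ t ≤ N, ∀ y, AgreeOn w N (P + t) y → w (P + t + N) = w (y + N) := by
    intro t ht y hy
    by_contra hne
    -- the tail of a right special factor is right special, hence it is `u`
    obtain ⟨L, rfl⟩ : ∃ L, N = L + 1 := ⟨N - 1, by omega⟩
    have htail : AgreeOn w L (P + t + 1) (P + 1) := by
      refine hw.rightSpecial_unique hy.tail ?_ (x' := P + 1) (y' := Q + 1) ?_ ?_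
      · rwa [show P + t + 1 + L = P + t + (L + 1) by omega, show y + 1 + L = y + (L + 1) by omega]
      · intro k hk
        have := hPQ (k + 1) (by omega) (by omega)
        rwa [show P + 1 + k = P + (k + 1) by omega, show Q + 1 + k = Q + (k + 1) by omega]
      · rw [show P + 1 + L = P + (L + 1) by omega, show Q + 1 + L = Q + (L + 1) by omega, hP, hQ]
        exact hcd
    have hcons : ∀ k, 0 < k → k < L + 1 → w (P + t + k) = w (P + k) := by
      intro k hk hk'
      have := htail (k - 1) (by omega)
      rwa [show P + t + 1 + (k - 1) = P + t + k by omega,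
        show P + 1 + (k - 1) = P + k by omega] at this
    have htwo : w (P + t) = w P ∨ w (P + t) = w Q := by
      have : ∀ a b c : Fin 2, b ≠ c → a = b ∨ a = c := by decide
      exact this _ _ _ hcd
    rcases htwo with h0 | h0
    · have hag : AgreeOn w (L + 1) (P + t) P := by
        intro k hk
        rcases Nat.eq_zero_or_pos k with rfl | hkpos
        · exact h0
        · exact hcons k hkpos hk
      apply hne
      rw [← hns _ (hag.symm.trans hy), ← hns _ hag.symm]
    · refine avoid t ht ?_
      intro k hk
      rcases Nat.eq_zero_or_pos k with rfl | hkpos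
      · exact h0
      · exact (hcons k hkpos hk).trans (hPQ k hkpos hk)
  have hcol : ∃ s ∈ Finset.range (N + 1), ∃ t ∈ Finset.range (N + 1), s ≠ t ∧
      factorAt w N (P + s) = factorAt w N (P + t) := by
    have hfin : (factorSet w N \ {factorAt w N Q}).Finite := Set.toFinite _
    refine Finset.exists_ne_map_eq_of_card_lt_of_maps_to (t := hfin.toFinset) ?_ ?_
    · rw [← Set.ncard_eq_toFinset_card _ hfin, Set.ncard_sdiff_singleton_of_mem
        (show factorAt w N Q ∈ factorSet w N from ⟨Q, fun _ => rfl⟩), Finset.card_range]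
      have : (factorSet w N).ncard = N + 1 := hw N hN
      omega
    · intro t ht
      simp only [Finset.coe_range, Set.mem_Iio] at ht
      simp only [Set.Finite.coe_toFinset]
      refine ⟨⟨P + t, fun _ => rfl⟩, ?_⟩
      intro h
      exact avoid t (by omega) (factorAt_eq_iff.mp h)
  have hcol' : ∃ s t, s < t ∧ t ≤ N ∧ AgreeOn w N (P + s) (P + t) := by
    obtain ⟨s, hs, t, ht, hst, h⟩ := hcol
    rw [factorAt_eq_iff] at h
    simp only [Finset.mem_range] at hs ht
    rcases Nat.lt_or_gt_of_ne hst with h' | h'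
    · exact ⟨s, t, h', by omega, h⟩
    · exact ⟨t, s, h', by omega, h.symm⟩
  obtain ⟨s, t, hst, htN, hag⟩ := hcol'
  have main : ∀ k, AgreeOn w N (P + s + k) (P + t + k) ∧
      ∀ y, AgreeOn w N (P + s + k) y → w (P + s + k + N) = w (y + N) := by
    intro k
    induction k using Nat.strong_induction_on with
    | _ k ih =>
      have hA : AgreeOn w N (P + s + k) (P + t + k) := by
        rcases Nat.eq_zero_or_pos k with rfl | hk
        · exact hag
        · obtain ⟨h1, h2⟩ := ih (k - 1) (by omega)
          have := (h1.succ (h2 _ h1)).tail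
          rwa [show P + s + (k - 1) + 1 = P + s + k by omega,
            show P + t + (k - 1) + 1 = P + t + k by omega] at this
      refine ⟨hA, ?_⟩
      by_cases hk : k < t - s
      · have := nrs (s + k) (by omega)
        rwa [← Nat.add_assoc] at this
      · obtain ⟨h1, h2⟩ := ih (k - (t - s)) (by omega)
        rw [show P + t + (k - (t - s)) = P + s + k by omega] at h1
        intro y hy
        rw [← h2 _ (h1.trans hy), ← h2 _ h1]
  refine hw.not_eventually_periodic (s := P + s) (τ := t - s) (by omega) ?_
  intro x hx
  have := (main (x - (P + s))).1 0 (by omega)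
  rw [show P + s + (x - (P + s)) + 0 = x by omega,
    show P + t + (x - (P + s)) + 0 = x + (t - s) by omega] at this
  exact this.symm

lemma windowWeight_succ (w : ℕ → Fin 2) (i n : ℕ) :
    windowWeight w i (n + 1) = windowWeight w i n + (w (i + n) : ℕ) := by
  simp [windowWeight, Finset.sum_range_succ]

lemma windowWeight_add (w : ℕ → Fin 2) (i n l : ℕ) :
    windowWeight w i (n + l) = windowWeight w i n + windowWeight w (i + n) l := by
  simp [windowWeight, Finset.sum_range_add, Nat.add_assoc]

lemma windowWeight_zero (w : ℕ → Fin 2) (i : ℕ) : windowWeight w i 0 = 0 := by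
  simp [windowWeight]

lemma windowWeight_one (w : ℕ → Fin 2) (i : ℕ) : windowWeight w i 1 = (w i : ℕ) := by
  simp [windowWeight]

/-- Sturmian words are balanced: the weights of two factors of equal length differ by at most one.
In a shortest violating pair, the two factors are `0 u 0` and `1 u 1` with `u` a palindrome. -/
theorem IsSturmian.balanced (hw : IsSturmian w) (n i j : ℕ) :
    windowWeight w j n ≤ windowWeight w i n + 1 := by
  induction n using Nat.strong_induction_on generalizing i j with
  | _ n ih =>
  by_contra hcon
  push Not at hcon
  have hbit : ∀ x, (w x : ℕ) ≤ 1 := fun x => by omega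
  obtain ⟨N, rfl⟩ : ∃ N, n = N + 1 := by
    refine ⟨n - 1, ?_⟩
    rcases Nat.eq_zero_or_pos n with rfl | h
    · simp [windowWeight_zero] at hcon
    · omega
  have hD : ∀ k, 0 < k → k < N + 1 → windowWeight w j k = windowWeight w i k + 1 := by
    intro k hk hk'
    have h1 := ih k hk' i j
    have h2 := ih (N + 1 - k) (by omega) (i + k) (j + k)
    have h3 := windowWeight_add w i k (N + 1 - k)
    have h4 := windowWeight_add w j k (N + 1 - k)
    rw [show k + (N + 1 - k) = N + 1 by omega] at h3 h4
    omega
  have hN : 1 ≤ N := by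
    by_contra h
    obtain rfl : N = 0 := by omega
    have := hbit j
    simp only [Nat.zero_add, windowWeight_one] at hcon
    omega
  have h0 := hD 1 (by omega) (by omega)
  simp only [windowWeight_one] at h0
  have hi0 : (w i : ℕ) = 0 := by have := hbit j; omega
  have hj0 : (w j : ℕ) = 1 := by omega
  have hlast := hD N (by omega) (by omega)
  rw [windowWeight_succ, windowWeight_succ] at hcon
  have hiN : (w (i + N) : ℕ) = 0 := by have := hbit (j + N); omega
  have hjN : (w (j + N) : ℕ) = 1 := by have := hbit (j + N); omega
  have hmid : ∀ k, 0 < k → k < N → w (i + k) = w (j + k) := by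
    intro k hk hk'
    have h1 := hD k hk (by omega)
    have h2 := hD (k + 1) (by omega) (by omega)
    rw [windowWeight_succ, windowWeight_succ] at h2
    apply Fin.ext
    omega
  -- comparing prefixes of one factor with suffixes of the other shows that `u` is a palindrome
  have hsum : ∀ k, 0 < k → k ≤ N →
      windowWeight w j k = windowWeight w (i + (N + 1 - k)) k + 1 := by
    intro k hk hkN
    have e1 := hD (N + 1 - k) (by omega) (by omega)
    have e3 := windowWeight_add w i (N + 1 - k) k
    have e4 := windowWeight_add w j (N + 1 - k) k
    rw [show N + 1 - k + k = N + 1 by omega] at e3 e4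
    have e5 := ih k (by omega) (i + (N + 1 - k)) j
    have e6 := ih k (by omega) i (j + (N + 1 - k))
    have e7 := hD k hk (by omega)
    rw [windowWeight_succ] at e3 e4
    omega
  have hpal : ∀ k, 0 < k → k < N → w (j + k) = w (i + (N - k)) := by
    intro k hk hkN
    have e1 := hsum k hk (by omega)
    have e2 := hsum (k + 1) (by omega) (by omega)
    rw [windowWeight_succ, show N + 1 - (k + 1) = N - k by omega, Nat.add_comm k 1,
      windowWeight_add, windowWeight_one, show i + (N - k) + 1 = i + (N + 1 - k) by omega] at e2
    apply Fin.ext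
    omega
  by_cases hns : ∀ y, AgreeOn w N i y → w (i + N) = w (y + N)
  · refine hw.false_of_palindrome hN (P := i) (Q := j) ?_ ?_ ?_ hmid ?_ hns
    · intro h
      have := congrArg Fin.val h
      omega
    · exact Fin.ext (by omega)
    · exact Fin.ext (by omega)
    · exact fun k hk hk' => (hmid k hk hk').trans (hpal k hk hk')
  · push Not at hns
    obtain ⟨y, hy, hyne⟩ := hns
    refine hw.false_of_palindrome hN (P := j) (Q := i) ?_ ?_ ?_
      (fun k hk hk' => (hmid k hk hk').symm) ?_ ?_
    · intro h
      have := congrArg Fin.val h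
      omega
    · exact Fin.ext (by omega)
    · exact Fin.ext (by omega)
    · exact fun k hk hk' => (hpal k hk hk').trans (hmid _ (by omega) (by omega))
    · intro z hz
      by_contra hzne
      -- both `0 u` and `1 u` would be right special
      have := hw.rightSpecial_unique hy hyne hz hzne 0 (by omega)
      have := congrArg Fin.val this
      simp only [Nat.add_zero] at this
      omega

lemma windowWeight_le (w : ℕ → Fin 2) (i n : ℕ) : windowWeight w i n ≤ n := by
  induction n with
  | zero => simp [windowWeight_zero]
  | succ n ih =>
    rw [windowWeight_succ]
    omega

/-- Two windows of equal length in a periodic word contain the same number of ones up to the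
period: the full windows obtained by sliding along one period differ only at their ends. -/
lemma windowWeight_le_of_periodic {T : ℕ} (hT : 0 < T) (hper : Function.Periodic w T) (i n : ℕ) :
    windowWeight w i n ≤ windowWeight w 0 n + T ∧ windowWeight w 0 n ≤ windowWeight w i n + T := by
  have hmod : windowWeight w i n = windowWeight w (i % T) n := by
    unfold windowWeight
    refine Finset.sum_congr rfl fun s _ => ?_
    rw [← hper.map_mod_nat (i + s), ← hper.map_mod_nat (i % T + s), Nat.mod_add_mod]
  have hlt := Nat.mod_lt i hT
  have e1 := windowWeight_add w 0 (i % T) n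
  have e2 := windowWeight_add w 0 n (i % T)
  rw [Nat.add_comm n] at e2
  have e3 := windowWeight_le w 0 (i % T)
  have e4 := windowWeight_le w (0 + n) (i % T)
  rw [Nat.zero_add] at e1
  omega

/-- Periodic and Sturmian words have uniformly distributed ones and at most linear complexity. -/
lemma exists_uniform_bound (hw : IsPeriodicWord w ∨ IsSturmian w) :
    ∃ C : ℕ, (∀ i n, windowWeight w i n ≤ windowWeight w 0 n + C ∧
      windowWeight w 0 n ≤ windowWeight w i n + C) ∧
      ∀ n, 1 ≤ n → wordComplexity w n ≤ C * (n + 1) := by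
  rcases hw with ⟨T, hT, hper⟩ | hw
  · refine ⟨T, fun i n => windowWeight_le_of_periodic hT hper i n, fun n _ => ?_⟩
    have := wordComplexity_le_of_eventually_periodic (s := 0) hT (fun x _ => hper x) n
    nlinarith
  · refine ⟨1, fun i n => ⟨hw.balanced n 0 i, hw.balanced n i 0⟩, fun n hn => ?_⟩
    rw [hw n hn]
    omega

end Words

/-! ### The letters met along the chain of the `z`'s -/

section Positions

/-- The basis element at position `p = (i, j)` is the last one `z i j` of its block, so that the
letter leading from it to the next one is `b`; otherwise that letter is `a`. -/
def IsBPos (K : ℕ → ℕ) (p : ℕ × ℕ) : Prop := p.2 + 1 = K p.1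

instance (K : ℕ → ℕ) : DecidablePred (IsBPos K) :=
  fun p => inferInstanceAs (Decidable (p.2 + 1 = K p.1))

/-- The basis elements `z` form a chain, along which one moves by multiplying by `a` or `b` on the
right. A position `(i, j)` with `j < K i` stands for `z i j`, and `nextPos` is the next position. -/
def nextPos (K : ℕ → ℕ) (p : ℕ × ℕ) : ℕ × ℕ :=
  if IsBPos K p then (p.1 + 1, 0) else (p.1, p.2 + 1)

/-- The position reached from `p` in `n` steps. -/
def posAt (K : ℕ → ℕ) (p : ℕ × ℕ) (n : ℕ) : ℕ × ℕ := (nextPos K)^[n] p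

/-- The number of letters `b` among the first `n` letters read from position `p`. -/
def bCount (K : ℕ → ℕ) (p : ℕ × ℕ) (n : ℕ) : ℕ := Nat.count (fun k => IsBPos K (posAt K p k)) n

/-- The first `n` letters read from position `p`; `true` stands for `b`. -/
def posWord (K : ℕ → ℕ) (n : ℕ) (p : ℕ × ℕ) : Fin n → Bool :=
  fun k => decide (IsBPos K (posAt K p k))

variable {K : ℕ → ℕ}

lemma posAt_succ (p : ℕ × ℕ) (n : ℕ) : posAt K p (n + 1) = nextPos K (posAt K p n) :=
  Function.iterate_succ_apply' _ _ _

lemma bCount_succ (p : ℕ × ℕ) (n : ℕ) :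
    bCount K p (n + 1) = bCount K p n + if IsBPos K (posAt K p n) then 1 else 0 :=
  Nat.count_succ _ _

lemma bCount_le (p : ℕ × ℕ) (n : ℕ) : bCount K p n ≤ n := Nat.count_le _

lemma isBPos_iff_of_posWord_eq {n : ℕ} {p q : ℕ × ℕ} (h : posWord K n p = posWord K n q) {k : ℕ}
    (hk : k < n) : IsBPos K (posAt K p k) ↔ IsBPos K (posAt K q k) := by
  have := congrFun h ⟨k, hk⟩
  simpa [posWord] using this

lemma bCount_eq_of_posWord_eq {n : ℕ} {p q : ℕ × ℕ} (h : posWord K n p = posWord K n q) {k : ℕ}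
    (hk : k ≤ n) : bCount K p k = bCount K q k := by
  induction k with
  | zero => rfl
  | succ k ih =>
    rw [bCount_succ, bCount_succ, ih (by omega)]
    simp only [isBPos_iff_of_posWord_eq h (show k < n by omega)]

lemma posAt_valid (hK : ∀ i, 0 < K i) {p : ℕ × ℕ} (hp : p.2 < K p.1) (n : ℕ) :
    (posAt K p n).2 < K (posAt K p n).1 := by
  induction n with
  | zero => exact hp
  | succ n ih =>
    rw [posAt_succ, nextPos]
    split_ifs with h
    · exact hK _
    · simp only [IsBPos] at h ⊢
      omega

lemma posAt_fst (p : ℕ × ℕ) (n : ℕ) : (posAt K p n).1 = p.1 + bCount K p n := by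
  induction n with
  | zero => rfl
  | succ n ih =>
    rw [posAt_succ, bCount_succ, nextPos]
    by_cases h : IsBPos K (posAt K p n)
    · rw [if_pos h, if_pos h, ih, Nat.add_assoc]
    · rw [if_neg h, if_neg h, ih, Nat.add_zero]

/-- Distances along the chain, measured from `z 0 0`. -/
lemma posAt_sum (p : ℕ × ℕ) (n : ℕ) :
    ∑ s ∈ Finset.range (posAt K p n).1, K s + (posAt K p n).2
      = ∑ s ∈ Finset.range p.1, K s + p.2 + n := by
  induction n with
  | zero => rfl
  | succ n ih =>
    rw [posAt_succ, nextPos]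
    split_ifs with h
    · simp only [Finset.sum_range_succ, Nat.add_zero]
      unfold IsBPos at h
      omega
    · simp only
      omega

variable {m : ℕ} {w : ℕ → Fin 2}

lemma wordSeq_pos (hm : 2 ≤ m) (i : ℕ) : 0 < wordSeq m w i := by
  unfold wordSeq
  omega

lemma wordSeq_le (i : ℕ) : wordSeq m w i ≤ m + 1 := by
  unfold wordSeq
  omega

lemma sum_wordSeq (i r : ℕ) :
    ∑ s ∈ Finset.range (i + r), wordSeq m w s
      = ∑ s ∈ Finset.range i, wordSeq m w s + (m * r + windowWeight w i r) := by
  rw [Finset.sum_range_add, windowWeight]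
  simp only [wordSeq, Finset.sum_add_distrib, Finset.sum_const, Finset.card_range, smul_eq_mul]
  ring

/-- The number `r` of letters `b` in a factor of length `n` satisfies `n ≈ m r + h`, where `h` is
the number of ones in the corresponding window of length `r` of `w`. -/
lemma bCount_window (hm : 2 ≤ m) {p : ℕ × ℕ} (hp : p.2 < wordSeq m w p.1) (n : ℕ) :
    n ≤ m * bCount (wordSeq m w) p n + windowWeight w p.1 (bCount (wordSeq m w) p n) + (m + 1) ∧
    m * bCount (wordSeq m w) p n + windowWeight w p.1 (bCount (wordSeq m w) p n)
      ≤ n + (m + 1) := by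
  have h1 := posAt_sum (K := wordSeq m w) p n
  have h2 := posAt_valid (wordSeq_pos hm) hp n
  rw [posAt_fst, sum_wordSeq] at h1
  rw [posAt_fst] at h2
  have h3 := wordSeq_le (m := m) (w := w) p.1
  have h4 := wordSeq_le (m := m) (w := w) (p.1 + bCount (wordSeq m w) p n)
  omega

/-- A sequence which is linear up to `o(r)` is linear up to `δ r + O(1)`. -/
lemma HasSlope.exists_abs_sub_le {α : ℝ} (hα : HasSlope w α) {δ : ℝ} (hδ : 0 < δ) :
    ∃ D : ℝ, 0 ≤ D ∧ ∀ r : ℕ, |(windowWeight w 0 r : ℝ) - α * r| ≤ δ * r + D := by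
  have hα' := Metric.tendsto_atTop.mp hα δ hδ
  obtain ⟨R, hR⟩ := hα'
  refine ⟨R * (1 + |α|), by positivity, fun r => ?_⟩
  have hw : ∑ i ∈ Finset.range r, ((w i : ℕ) : ℝ) = windowWeight w 0 r := by
    simp [windowWeight]
  by_cases hr : R ≤ r
  · have h1 := hR r hr
    rw [hw, Real.dist_eq] at h1
    rcases Nat.eq_zero_or_pos r with rfl | hpos
    · simp only [windowWeight_zero, Nat.cast_zero, mul_zero, sub_zero, abs_zero, zero_add]
      positivity
    · have hpos' : (0 : ℝ) < r := by exact_mod_cast hpos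
      have h2 : (windowWeight w 0 r : ℝ) - α * r = ((windowWeight w 0 r : ℝ) / r - α) * r := by
        field_simp
      rw [h2, abs_mul, abs_of_pos hpos']
      have h3 : 0 ≤ (R : ℝ) * (1 + |α|) := by positivity
      nlinarith
  · have h1 : (windowWeight w 0 r : ℝ) ≤ r := by exact_mod_cast windowWeight_le w 0 r
    have h2 : (r : ℝ) ≤ R := by exact_mod_cast (not_le.mp hr).le
    have h3 : |(windowWeight w 0 r : ℝ) - α * r| ≤ r + |α| * r := by
      calc _ ≤ |(windowWeight w 0 r : ℝ)| + |α * r| := abs_sub _ _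
        _ ≤ r + |α| * r := by
          rw [abs_mul, Nat.abs_cast, Nat.abs_cast]
          gcongr
    have h4 : 0 ≤ δ * r := by positivity
    have h5 : (r : ℝ) * (1 + |α|) ≤ R * (1 + |α|) := by gcongr
    linarith

lemma HasSlope.nonneg {α : ℝ} (hα : HasSlope w α) : 0 ≤ α :=
  ge_of_tendsto' hα fun n => by positivity

/-- The frequency of the letter `b` in the factors of length `n` tends to `1 / (m + α)`, uniformly
in the factor. -/
lemma bCount_uniform (hm : 2 ≤ m) {α : ℝ} (hα : HasSlope w α) {C : ℕ}
    (hC : ∀ i n, windowWeight w i n ≤ windowWeight w 0 n + C ∧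
      windowWeight w 0 n ≤ windowWeight w i n + C) {ε : ℝ} (hε : 0 < ε) :
    ∃ N : ℕ, ∀ n, N ≤ n → ∀ p : ℕ × ℕ, p.2 < wordSeq m w p.1 →
      |(bCount (wordSeq m w) p n : ℝ) - 1 / (m + α) * n| ≤ ε * n := by
  obtain ⟨D, hD0, hD⟩ := hα.exists_abs_sub_le (show 0 < ε / 2 by positivity)
  obtain ⟨N, hN⟩ := exists_nat_ge ((D + C + m + 1) / (ε / 2))
  refine ⟨N, fun n hn p hp => ?_⟩
  have hα0 := hα.nonneg
  have hm' : (2 : ℝ) ≤ m := by exact_mod_cast hm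
  have hn' : (N : ℝ) ≤ n := by exact_mod_cast hn
  obtain ⟨h1, h2⟩ := bCount_window hm hp n
  set r := bCount (wordSeq m w) p n with hr
  obtain ⟨h3, h4⟩ := hC p.1 r
  have h5 := abs_le.mp (hD r)
  have hrn : (r : ℝ) ≤ n := by exact_mod_cast bCount_le p n
  have hbig : D + C + m + 1 ≤ ε / 2 * n := by
    rw [div_le_iff₀ (by positivity)] at hN
    nlinarith
  have h1' : (n : ℝ) ≤ m * r + windowWeight w p.1 r + (m + 1) := by exact_mod_cast h1
  have h2' : (m : ℝ) * r + windowWeight w p.1 r ≤ n + (m + 1) := by exact_mod_cast h2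
  have h3' : (windowWeight w p.1 r : ℝ) ≤ windowWeight w 0 r + C := by exact_mod_cast h3
  have h4' : (windowWeight w 0 r : ℝ) ≤ windowWeight w p.1 r + C := by exact_mod_cast h4
  have h6 : ε / 2 * r ≤ ε / 2 * n := by gcongr
  have hden : 0 < (m : ℝ) + α := by linarith
  have h7 : |((m : ℝ) + α) * r - n| ≤ ε * n := by
    rw [abs_le]
    constructor <;> linarith [h5.1, h5.2]
  have h8 : (r : ℝ) - 1 / (m + α) * n = (((m : ℝ) + α) * r - n) / (m + α) := by
    field_simp
  rw [h8, abs_div, abs_of_pos hden]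
  exact (div_le_self (abs_nonneg _) (by linarith)).trans h7

lemma posAt_congr {i i' j : ℕ} {n : ℕ} (h : AgreeOn w n i i') {k : ℕ} (hk : k ≤ n) :
    ∃ s j', s ≤ k ∧ posAt (wordSeq m w) (i, j) k = (i + s, j') ∧
      posAt (wordSeq m w) (i', j) k = (i' + s, j') := by
  induction k with
  | zero => exact ⟨0, j, le_rfl, rfl, rfl⟩
  | succ k ih =>
    obtain ⟨s, j', hs, h1, h2⟩ := ih (by omega)
    have hws : wordSeq m w (i + s) = wordSeq m w (i' + s) := by
      unfold wordSeq
      rw [h s (by omega)]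
    rw [posAt_succ, posAt_succ, h1, h2, nextPos, nextPos]
    have hiff : IsBPos (wordSeq m w) (i + s, j') ↔ IsBPos (wordSeq m w) (i' + s, j') := by
      simp only [IsBPos, hws]
    by_cases hb : IsBPos (wordSeq m w) (i' + s, j')
    · rw [if_pos (hiff.mpr hb), if_pos hb]
      exact ⟨s + 1, 0, by omega, rfl, rfl⟩
    · rw [if_neg (fun h => hb (hiff.mp h)), if_neg hb]
      exact ⟨s, j' + 1, by omega, rfl, rfl⟩

lemma posWord_congr {i i' j n : ℕ} (h : AgreeOn w n i i') :
    posWord (wordSeq m w) n (i, j) = posWord (wordSeq m w) n (i', j) := by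
  funext k
  obtain ⟨s, j', hs, h1, h2⟩ := posAt_congr (m := m) (j := j) h k.2.le
  have hws : wordSeq m w (i + s) = wordSeq m w (i' + s) := by
    unfold wordSeq
    rw [h s (by omega)]
  simp only [posWord, h1, h2, IsBPos, hws]

/-- The words of length `n` read along the chain. -/
noncomputable def posWords (K : ℕ → ℕ) (n : ℕ) : Finset (Fin n → Bool) :=
  (Set.toFinite {u | ∃ p : ℕ × ℕ, p.2 < K p.1 ∧ posWord K n p = u}).toFinset

lemma mem_posWords {n : ℕ} {u : Fin n → Bool} :
    u ∈ posWords K n ↔ ∃ p : ℕ × ℕ, p.2 < K p.1 ∧ posWord K n p = u := by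
  simp [posWords]

/-- A word read along the chain is determined by its offset in the first block and by a factor of
`w`. -/
lemma card_posWords_le (n : ℕ) :
    (posWords (wordSeq m w) n).card ≤ (m + 1) * wordComplexity w n := by
  have hfin : (factorSet w n).Finite := Set.toFinite _
  choose! pos hpos using fun u (hu : u ∈ factorSet w n) => hu
  have hsub : posWords (wordSeq m w) n ⊆
      (Finset.range (m + 1) ×ˢ hfin.toFinset).image
        fun x => posWord (wordSeq m w) n (pos x.2, x.1) := by
    intro u hu
    obtain ⟨p, hp, rfl⟩ := mem_posWords.mp hu
    have hmem : factorAt w n p.1 ∈ factorSet w n := ⟨p.1, fun _ => rfl⟩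
    refine Finset.mem_image.mpr ⟨(p.2, factorAt w n p.1), ?_, ?_⟩
    · simp only [Finset.mem_product, Finset.mem_range, Set.Finite.mem_toFinset]
      exact ⟨lt_of_lt_of_le hp (wordSeq_le _), hmem⟩
    · exact posWord_congr fun k hk => (hpos _ hmem ⟨k, hk⟩).symm
  calc _ ≤ _ := Finset.card_le_card hsub
    _ ≤ _ := Finset.card_image_le
    _ = _ := by
      rw [Finset.card_product, Finset.card_range, ← Set.ncard_eq_toFinset_card _ hfin,
        wordComplexity_eq]

end Positions

/-! ### Exponential growth of binomial coefficients -/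

section Binomials

lemma choose_mul_pow_le_one (n r : ℕ) {x : ℝ} (hx : 0 ≤ x) (hx1 : x ≤ 1) :
    (n.choose r : ℝ) * x ^ r * (1 - x) ^ (n - r) ≤ 1 := by
  rcases Nat.lt_or_ge n r with h | h
  · simp [Nat.choose_eq_zero_of_lt h]
  have h1 := add_pow x (1 - x) n
  rw [add_sub_cancel, one_pow] at h1
  have hx' : 0 ≤ 1 - x := by linarith
  refine le_trans (le_of_eq ?_) (le_trans (Finset.single_le_sum
    (f := fun k => x ^ k * (1 - x) ^ (n - k) * (n.choose k : ℝ))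
    (fun k _ => by positivity) (Finset.mem_range.mpr (Nat.lt_succ_of_le h))) h1.ge)
  ring

/-- The largest term in the expansion of `(r + (n - r)) ^ n` is the one of index `r`. -/
lemma choose_mul_pow_le (r s k : ℕ) (hk : k ≤ r + s) :
    (r + s).choose k * r ^ k * s ^ (r + s - k) ≤ (r + s).choose r * r ^ r * s ^ s := by
  have step : ∀ k, k < r + s → ((r + s).choose (k + 1) * r ^ (k + 1) * s ^ (r + s - (k + 1))) *
      ((k + 1) * s) = ((r + s).choose k * r ^ k * s ^ (r + s - k)) * ((r + s - k) * r) := by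
    intro k hk
    obtain ⟨d, hd⟩ : ∃ d, r + s = k + 1 + d := ⟨r + s - (k + 1), by omega⟩
    have h := Nat.choose_succ_right_eq (r + s) k
    rw [show r + s - (k + 1) = d by omega, show r + s - k = d + 1 by omega] at *
    calc _ = ((r + s).choose (k + 1) * (k + 1)) * (r ^ (k + 1) * s ^ (d + 1)) := by ring
      _ = _ := by rw [h]; ring
  rcases Nat.eq_zero_or_pos r with rfl | hr
  · rcases Nat.eq_zero_or_pos k with rfl | hk0
    · simp
    · simp [hk0.ne']
  rcases Nat.eq_zero_or_pos s with rfl | hs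
  · rcases Nat.lt_or_ge k r with h | h
    · simp [show r - k ≠ 0 by omega]
    · obtain rfl : k = r := by omega
      simp
  rcases Nat.le_total k r with h | h
  · refine Nat.decreasingInduction' (P := fun k => (r + s).choose k * r ^ k * s ^ (r + s - k) ≤
      (r + s).choose r * r ^ r * s ^ s) ?_ h ?_
    · intro j hj _ ih
      refine le_trans ?_ ih
      refine Nat.le_of_mul_le_mul_right (c := (j + 1) * s) ?_ (by positivity)
      rw [step j (by omega)]
      refine Nat.mul_le_mul_left _ ?_
      obtain ⟨d, rfl⟩ : ∃ d, r = j + 1 + d := ⟨r - (j + 1), by omega⟩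
      rw [show j + 1 + d + s - j = 1 + d + s by omega]
      nlinarith
    · rw [Nat.add_sub_cancel_left]
  · induction k, h using Nat.le_induction with
    | base => rw [Nat.add_sub_cancel_left]
    | succ j hj ih =>
      refine le_trans ?_ (ih (by omega))
      refine Nat.le_of_mul_le_mul_right (c := (j + 1) * s) ?_ (by positivity)
      rw [step j (by omega)]
      refine Nat.mul_le_mul_left _ ?_
      obtain ⟨d, rfl⟩ : ∃ d, s = d + (j + 1 - r) := ⟨s - (j + 1 - r), by omega⟩
      obtain ⟨e, rfl⟩ : ∃ e, j = r + e := ⟨j - r, by omega⟩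
      rw [show r + (d + (r + e + 1 - r)) - (r + e) = d + 1 by omega,
        show r + e + 1 - r = e + 1 by omega]
      nlinarith [Nat.zero_le (e * d), Nat.zero_le (e * e)]

lemma pow_le_choose_mul (r s : ℕ) :
    (r + s) ^ (r + s) ≤ (r + s + 1) * ((r + s).choose r * r ^ r * s ^ s) := by
  rw [add_pow, ← smul_eq_mul, ← Finset.card_range (r + s + 1), ← Finset.sum_const,
    Finset.card_range]
  refine Finset.sum_le_sum fun k hk => ?_
  have := choose_mul_pow_le r s k (by simpa [Nat.lt_succ_iff] using hk)
  calc _ = (r + s).choose k * r ^ k * s ^ (r + s - k) := by simp only [Nat.cast_id]; ring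
    _ ≤ _ := this

lemma mul_binEntropy_div_le_log_choose {n r : ℕ} (hr : r ≤ n) (hn : 0 < n) :
    n * Real.binEntropy (r / n) - Real.log (n + 1) ≤ Real.log (n.choose r) := by
  obtain ⟨s, rfl⟩ : ∃ s, n = r + s := ⟨n - r, by omega⟩
  have h := pow_le_choose_mul r s
  have hch : 0 < (r + s).choose r := Nat.choose_pos hr
  have hpos : ∀ t : ℕ, (0 : ℝ) < (t : ℝ) ^ t := by
    intro t
    rcases Nat.eq_zero_or_pos t with rfl | ht
    · simp
    · positivity
  have h' : (((r + s : ℕ) : ℝ)) ^ (r + s) ≤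
      ((r + s : ℕ) + 1 : ℝ) * (((r + s).choose r : ℝ) * (r : ℝ) ^ r * (s : ℝ) ^ s) := by
    exact_mod_cast h
  have hlog := Real.log_le_log (hpos (r + s)) h'
  rw [Real.log_mul (by positivity) (by have := hpos r; have := hpos s; positivity),
    Real.log_mul (by have := hpos r; positivity) (hpos s).ne',
    Real.log_mul (by positivity) (hpos r).ne', Real.log_pow, Real.log_pow, Real.log_pow] at hlog
  have hent : ((r + s : ℕ) : ℝ) * Real.binEntropy (r / (r + s : ℕ)) =
      ((r + s : ℕ) : ℝ) * Real.log (r + s : ℕ) - r * Real.log r - s * Real.log s := by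
    have hn0 : ((r + s : ℕ) : ℝ) ≠ 0 := by positivity
    have h1 : (1 : ℝ) - r / (r + s : ℕ) = s / (r + s : ℕ) := by
      field_simp
      push_cast
      ring
    have hdiv : ∀ t : ℕ, ((r + s : ℕ) : ℝ) * Real.negMulLog (t / (r + s : ℕ)) =
        t * Real.log (r + s : ℕ) - t * Real.log t := by
      intro t
      rcases Nat.eq_zero_or_pos t with rfl | ht
      · simp
      · have ht0 : (t : ℝ) ≠ 0 := by positivity
        rw [Real.negMulLog, Real.log_div ht0 hn0]
        field_simp
        ring
    rw [Real.binEntropy_eq_negMulLog_add_negMulLog_one_sub, h1, mul_add, hdiv, hdiv]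
    push_cast
    ring
  rw [hent]
  linarith

lemma log_entropyPhi {x : ℝ} (hx : 0 < x) (hx1 : x < 1) :
    Real.log (entropyPhi x) = Real.binEntropy x := by
  have h1 : 0 < 1 - x := by linarith
  rw [entropyPhi, one_div, Real.log_inv, Real.log_mul (by positivity) (by positivity),
    Real.log_rpow hx, Real.log_rpow h1, Real.binEntropy_eq_negMulLog_add_negMulLog_one_sub,
    Real.negMulLog, Real.negMulLog]
  ring

lemma entropyPhi_pos {x : ℝ} (hx : 0 < x) (hx1 : x < 1) : 0 < entropyPhi x := by
  have h1 : 0 < 1 - x := by linarith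
  rw [entropyPhi]
  positivity

/-- Binomial coefficients `n.choose r` with `r / n` close to `x` are at most `exp (n (H(x) + δ))`:
compare with the binomial distribution of parameter `x`. -/
lemma choose_le_exp {x : ℝ} (hx : 0 < x) (hx1 : x < 1) {δ : ℝ} (hδ : 0 < δ) :
    ∃ ε > 0, ∀ n r : ℕ, r ≤ n → |(r : ℝ) - x * n| ≤ ε * n →
      (n.choose r : ℝ) ≤ Real.exp (n * (Real.binEntropy x + δ)) := by
  have h1 : 0 < 1 - x := by linarith
  set L := |Real.log (1 - x) - Real.log x| with hL
  refine ⟨δ / (L + 1), by positivity, fun n r hr h => ?_⟩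
  have hch : (0 : ℝ) < n.choose r := by exact_mod_cast Nat.choose_pos hr
  rw [← Real.log_le_iff_le_exp hch]
  have hlog := Real.log_le_log (by positivity) (choose_mul_pow_le_one n r hx.le hx1.le)
  rw [Real.log_one, Real.log_mul (by positivity) (by positivity),
    Real.log_mul (by positivity) (by positivity), Real.log_pow, Real.log_pow, Nat.cast_sub hr]
    at hlog
  have hent : (n : ℝ) * Real.binEntropy x =
      -(x * n) * Real.log x - (n - x * n) * Real.log (1 - x) := by
    rw [Real.binEntropy_eq_negMulLog_add_negMulLog_one_sub, Real.negMulLog, Real.negMulLog]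
    ring
  have hkey : ((r : ℝ) - x * n) * (Real.log (1 - x) - Real.log x) ≤ δ * n := by
    calc _ ≤ |((r : ℝ) - x * n) * (Real.log (1 - x) - Real.log x)| := le_abs_self _
      _ = |(r : ℝ) - x * n| * L := abs_mul _ _
      _ ≤ (δ / (L + 1) * n) * L := by gcongr
      _ = δ * n * (L / (L + 1)) := by ring
      _ ≤ δ * n * 1 := by
        gcongr
        rw [div_le_one (by positivity)]
        linarith
      _ = δ * n := mul_one _
  rw [mul_add, hent]
  linarith

/-- A sequence squeezed, up to polynomial factors, between binomial coefficients with
frequencies tending to `x` grows like `Φ(x) ^ n`. -/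
lemma tendsto_rpow_of_choose_bounds {x : ℝ} (hx : 0 < x) (hx1 : x < 1) {c s : ℕ → ℕ} {D : ℕ}
    (hs : ∀ n, s n ≤ n) (hsx : Tendsto (fun n => (s n : ℝ) / n) atTop (𝓝 x))
    (hlow : ∀ n, 1 ≤ n → n.choose (s n) ≤ c (n + 1))
    (hup : ∀ ε > 0, ∀ᶠ n : ℕ in atTop, ∃ M : ℕ, c n ≤ D * (n + 1) ^ 3 * M ∧
      ∃ r, r ≤ n ∧ |(r : ℝ) - x * n| ≤ ε * n ∧ M = n.choose r) :
    Tendsto (fun n : ℕ => (c n : ℝ) ^ (1 / (n : ℝ))) atTop (𝓝 (entropyPhi x)) := by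
  have hcpos : ∀ n, 2 ≤ n → (0 : ℝ) < c n := by
    intro n hn
    obtain ⟨k, rfl⟩ : ∃ k, n = k + 1 := ⟨n - 1, by omega⟩
    exact_mod_cast lt_of_lt_of_le (Nat.choose_pos (hs k)) (hlow k (by omega))
  have hlogdiv : Tendsto (fun n : ℕ => Real.log ((n : ℝ) + 1) / n) atTop (𝓝 0) := by
    have h1 : Tendsto (fun y : ℝ => Real.log y / y) atTop (𝓝 0) := by
      simpa using Real.isLittleO_log_id_atTop.tendsto_div_nhds_zero
    have h2 := h1.comp (tendsto_natCast_atTop_atTop.comp (tendsto_add_atTop_nat 1))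
    have h3 : Tendsto (fun n : ℕ => ((n : ℝ) + 1) / n) atTop (𝓝 1) := by
      have := tendsto_const_nhds (x := (1 : ℝ)).add (tendsto_one_div_atTop_nhds_zero_nat (𝕜 := ℝ))
      rw [add_zero] at this
      refine this.congr' ?_
      filter_upwards [eventually_gt_atTop 0] with n hn
      have : (0 : ℝ) < n := by exact_mod_cast hn
      field_simp
    have h4 := h2.mul h3
    rw [zero_mul] at h4
    refine h4.congr' ?_
    filter_upwards [eventually_gt_atTop 0] with n hn
    have : (0 : ℝ) < n := by exact_mod_cast hn
    simp only [Function.comp_apply, Nat.cast_add, Nat.cast_one]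
    field_simp
  have hmain : Tendsto (fun n : ℕ => Real.log (c n) / n) atTop (𝓝 (Real.binEntropy x)) := by
    -- the lower bound is shifted by one, so that it is stated for `n + 1`
    have hlowlim : Tendsto (fun n : ℕ => ((n : ℝ) * Real.binEntropy (s n / n) -
        Real.log (n + 1)) / ((n : ℝ) + 1)) atTop (𝓝 (Real.binEntropy x)) := by
      have h1 : Tendsto (fun n : ℕ => Real.binEntropy (s n / n) - Real.log ((n : ℝ) + 1) / n)
          atTop (𝓝 (Real.binEntropy x)) := by
        simpa using ((Real.binEntropy_continuous.tendsto x).comp hsx).sub hlogdiv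
      have h2 := h1.mul (tendsto_natCast_div_add_atTop (𝕜 := ℝ) 1)
      rw [mul_one] at h2
      refine h2.congr' ?_
      filter_upwards [eventually_gt_atTop 0] with n hn
      have : (0 : ℝ) < n := by exact_mod_cast hn
      field_simp
    have hlowev : ∀ᶠ n : ℕ in atTop, ((n : ℝ) * Real.binEntropy (s n / n) -
        Real.log (n + 1)) / ((n : ℝ) + 1) ≤ Real.log (c (n + 1)) / ((n + 1 : ℕ) : ℝ) := by
      filter_upwards [eventually_ge_atTop 1] with n hn
      push_cast
      gcongr
      refine (mul_binEntropy_div_le_log_choose (hs n) (by omega)).trans ?_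
      refine Real.log_le_log (by exact_mod_cast Nat.choose_pos (hs n)) ?_
      exact_mod_cast hlow n hn
    rw [tendsto_order]
    constructor
    · intro y hy
      have h1 := (tendsto_order.mp hlowlim).1 y hy
      have h2 : ∀ᶠ n : ℕ in atTop, y < Real.log (c (n + 1)) / ((n + 1 : ℕ) : ℝ) := by
        filter_upwards [h1, hlowev] with n h1 h2 using h1.trans_le h2
      rw [eventually_atTop] at h2 ⊢
      obtain ⟨N, hN⟩ := h2
      refine ⟨N + 1, fun n hn => ?_⟩
      have := hN (n - 1) (by omega)
      rwa [Nat.sub_add_cancel (by omega)] at this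
    · intro y hy
      set δ := (y - Real.binEntropy x) / 2 with hδ
      have hδpos : 0 < δ := by
        rw [hδ]
        linarith
      obtain ⟨ε, hε, hch⟩ := choose_le_exp hx hx1 hδpos
      have hpoly : Tendsto (fun n : ℕ => Real.log D / n + 3 * (Real.log ((n : ℝ) + 1) / n) +
          (Real.binEntropy x + δ)) atTop (𝓝 (Real.binEntropy x + δ)) := by
        have h1 := tendsto_const_div_atTop_nhds_zero_nat (Real.log D)
        have := (h1.add (hlogdiv.const_mul 3)).add_const (Real.binEntropy x + δ)
        simpa using this
      have hev := (tendsto_order.mp hpoly).2 y (by rw [hδ]; linarith)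
      filter_upwards [hev, hup ε hε, eventually_ge_atTop 2] with n h1 h2 hn
      refine lt_of_le_of_lt ?_ h1
      obtain ⟨M, hM, r, hr, hrx, rfl⟩ := h2
      have hnpos : (0 : ℝ) < n := by exact_mod_cast (show 0 < n by omega)
      have hchp : (0 : ℝ) < n.choose r := by exact_mod_cast Nat.choose_pos hr
      have hMreal : (c n : ℝ) ≤ D * (n + 1) ^ 3 * n.choose r := by exact_mod_cast hM
      have hD : (0 : ℝ) < D := by
        rcases Nat.eq_zero_or_pos D with rfl | h
        · have := hcpos n hn
          simp only [Nat.cast_zero, zero_mul] at hMreal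
          linarith
        · exact_mod_cast h
      have hl := Real.log_le_log (hcpos n hn) hMreal
      rw [Real.log_mul (by positivity) hchp.ne', Real.log_mul hD.ne' (by positivity),
        Real.log_pow] at hl
      have hl2 : Real.log (n.choose r) ≤ n * (Real.binEntropy x + δ) := by
        rw [Real.log_le_iff_le_exp hchp]
        exact hch n r hr hrx
      rw [div_le_iff₀ hnpos]
      have : (Real.log D / n + 3 * (Real.log ((n : ℝ) + 1) / n) + (Real.binEntropy x + δ)) * n =
          Real.log D + 3 * Real.log ((n : ℝ) + 1) + n * (Real.binEntropy x + δ) := by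
        field_simp
      rw [this]
      push_cast at hl
      linarith
  have hexp := (Real.continuous_exp.tendsto _).comp hmain
  rw [← log_entropyPhi hx hx1, Real.exp_log (entropyPhi_pos hx hx1)] at hexp
  refine hexp.congr' ?_
  filter_upwards [eventually_ge_atTop 2] with n hn
  rw [Function.comp_apply, Real.rpow_def_of_pos (hcpos n hn)]
  congr 1
  ring

end Binomials

/-! ### Multilinear polynomials and substitutions -/

section Multilinear

variable {F : Type*} [Field F] {A : Type*} [NonUnitalNonAssocRing A] [Module F A]
  [IsScalarTower F A A] [SMulCommClass F A A] {V : Type*}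

lemma FreeNonUnitalNonAssocAlgebra.lift_single_one (φ : V → A) (t : FreeMagma V) :
    FreeNonUnitalNonAssocAlgebra.lift F φ (MonoidAlgebra.single t (1 : F)) =
      FreeMagma.lift φ t := by
  induction t using FreeMagma.recOnMul with
  | ih1 x => exact FreeNonUnitalNonAssocAlgebra.lift_of_apply F φ x
  | ih2 x y hx hy =>
    have h : (MonoidAlgebra.single (x * y) (1 : F)) =
        MonoidAlgebra.single x 1 * MonoidAlgebra.single y 1 := by
      rw [MonoidAlgebra.single_mul_single, one_mul]
    rw [h, map_mul, hx, hy, map_mul]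

lemma FreeMagma.letters_mul (s t : FreeMagma V) : (s * t).letters = s.letters + t.letters := rfl

lemma FreeMagma.letters_of (v : V) : (FreeMagma.of v).letters = {v} := rfl

lemma FreeMagma.card_letters_pos (t : FreeMagma V) : 0 < Multiset.card t.letters := by
  induction t using FreeMagma.recOnMul with
  | ih1 x => simp [FreeMagma.letters_of]
  | ih2 x y hx hy =>
    rw [FreeMagma.letters_mul, Multiset.card_add]
    omega

lemma FreeMagma.lift_congr_letters {φ ψ : V → A} (t : FreeMagma V)
    (h : ∀ v ∈ t.letters, φ v = ψ v) : FreeMagma.lift φ t = FreeMagma.lift ψ t := by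
  induction t using FreeMagma.recOnMul with
  | ih1 x => exact h x (by simp [FreeMagma.letters_of])
  | ih2 x y hx hy =>
    rw [map_mul, map_mul, hx fun v hv => h v ?_, hy fun v hv => h v ?_] <;>
      simp [FreeMagma.letters_mul, hv]

variable (F) in
/-- A monomial in which `v` occurs exactly once depends linearly on the value of `v`. -/
lemma FreeMagma.exists_linear_of_count_eq_one [DecidableEq V] (φ : V → A) (v : V)
    (t : FreeMagma V) (h : t.letters.count v = 1) :
    ∃ l : A →ₗ[F] A, ∀ x, FreeMagma.lift (Function.update φ v x) t = l x := by
  induction t using FreeMagma.recOnMul with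
  | ih1 y =>
    have : v = y := by
      by_contra hne
      simp [FreeMagma.letters_of, hne] at h
    subst this
    exact ⟨LinearMap.id, fun x => by simp⟩
  | ih2 s r hs hr =>
    rw [FreeMagma.letters_mul, Multiset.count_add] at h
    have hconst : ∀ u : FreeMagma V, u.letters.count v = 0 → ∀ x,
        FreeMagma.lift (Function.update φ v x) u = FreeMagma.lift φ u := by
      intro u hu x
      refine FreeMagma.lift_congr_letters u fun y hy => ?_
      have hyv : y ≠ v := by
        rintro rfl
        exact Multiset.count_eq_zero.mp hu hy
      rw [Function.update_of_ne hyv]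
    rcases Nat.eq_zero_or_pos (s.letters.count v) with h0 | h0
    · obtain ⟨l, hl⟩ := hr (by omega)
      exact ⟨LinearMap.mulLeft F (FreeMagma.lift φ s) ∘ₗ l, fun x => by
        simp [map_mul, hconst s h0 x, hl x]⟩
    · obtain ⟨l, hl⟩ := hs (by omega)
      exact ⟨LinearMap.mulRight F (FreeMagma.lift φ r) ∘ₗ l, fun x => by
        simp [map_mul, hconst r (by omega) x, hl x]⟩

lemma multilinearPolys_lift_congr {S : Finset V} {f : FreeNonUnitalNonAssocAlgebra F V}
    (hf : f ∈ multilinearPolys F S) {φ ψ : V → A} (h : ∀ v ∈ S, φ v = ψ v) :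
    FreeNonUnitalNonAssocAlgebra.lift F φ f = FreeNonUnitalNonAssocAlgebra.lift F ψ f := by
  induction hf using Submodule.span_induction with
  | mem x hx =>
    obtain ⟨t, ht, rfl⟩ := hx
    rw [FreeNonUnitalNonAssocAlgebra.lift_single_one, FreeNonUnitalNonAssocAlgebra.lift_single_one]
    exact FreeMagma.lift_congr_letters t fun v hv => h v (by rwa [ht] at hv)
  | zero => simp
  | add x y _ _ hx hy => rw [map_add, map_add, hx, hy]
  | smul c x _ hx => rw [map_smul, map_smul, hx]

lemma multilinearPolys_exists_linear [DecidableEq V] {S : Finset V}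
    {f : FreeNonUnitalNonAssocAlgebra F V}
    (hf : f ∈ multilinearPolys F S) (φ : V → A) {v : V} (hv : v ∈ S) :
    ∃ l : A →ₗ[F] A, ∀ x,
      FreeNonUnitalNonAssocAlgebra.lift F (Function.update φ v x) f = l x := by
  induction hf using Submodule.span_induction with
  | mem x hx =>
    obtain ⟨t, ht, rfl⟩ := hx
    simp only [FreeNonUnitalNonAssocAlgebra.lift_single_one]
    refine FreeMagma.exists_linear_of_count_eq_one F φ v t ?_
    rw [ht]
    exact Multiset.count_eq_one_of_mem S.nodup hv
  | zero => exact ⟨0, fun x => by simp⟩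
  | add x y _ _ hx hy =>
    obtain ⟨l, hl⟩ := hx
    obtain ⟨l', hl'⟩ := hy
    exact ⟨l + l', fun x => by rw [map_add, hl, hl', LinearMap.add_apply]⟩
  | smul c x _ hx =>
    obtain ⟨l, hl⟩ := hx
    exact ⟨c • l, fun x => by rw [map_smul, hl, LinearMap.smul_apply]⟩

/-- A multilinear polynomial that vanishes when the variables take values in the sets `X v` also
vanishes when they take values in the spans of these sets. -/
lemma multilinearPolys_lift_eq_zero_of_span {S : Finset V} {f : FreeNonUnitalNonAssocAlgebra F V}
    (hf : f ∈ multilinearPolys F S) (X : V → Set A)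
    (h : ∀ φ : V → A, (∀ v ∈ S, φ v ∈ X v) → FreeNonUnitalNonAssocAlgebra.lift F φ f = 0)
    (φ : V → A) (hφ : ∀ v ∈ S, φ v ∈ Submodule.span F (X v)) :
    FreeNonUnitalNonAssocAlgebra.lift F φ f = 0 := by
  classical
  have key : ∀ T ⊆ S, ∀ φ : V → A, (∀ v ∈ S, v ∉ T → φ v ∈ X v) →
      (∀ v ∈ T, φ v ∈ Submodule.span F (X v)) →
      FreeNonUnitalNonAssocAlgebra.lift F φ f = 0 := by
    intro T
    induction T using Finset.induction_on with
    | empty => exact fun _ φ h1 _ => h φ fun v hv => h1 v hv (by simp)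
    | insert v T hvT ih =>
      intro hTS φ h1 h2
      obtain ⟨l, hl⟩ := multilinearPolys_exists_linear hf φ (hTS (Finset.mem_insert_self v T))
      have hzero : ∀ x ∈ X v, l x = 0 := by
        intro x hx
        rw [← hl]
        refine ih ((Finset.subset_insert _ _).trans hTS) _ ?_ ?_
        · intro y hy hyT
          by_cases hyv : y = v
          · subst hyv
            simpa using hx
          · rw [Function.update_of_ne hyv]
            exact h1 y hy (by simp [hyv, hyT])
        · intro y hy
          have hyv : y ≠ v := fun h => hvT (h ▸ hy)
          rw [Function.update_of_ne hyv]
          exact h2 y (Finset.mem_insert_of_mem hy)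
      have hle : Submodule.span F (X v) ≤ LinearMap.ker l := Submodule.span_le.mpr hzero
      have := hle (h2 v (Finset.mem_insert_self v T))
      rw [LinearMap.mem_ker, ← hl, Function.update_eq_self] at this
      exact this
  exact key S subset_rfl φ (fun v hv hv' => absurd hv hv') hφ

/-- A quotient of a space by a subspace containing the common kernel of finitely many linear forms
has at most that dimension. -/
lemma finrank_quotient_le_of_ker_le {M ι : Type*} [AddCommGroup M] [Module F M] [Fintype ι]
    (L : M →ₗ[F] ι → F) {I : Submodule F M} (h : LinearMap.ker L ≤ I) :
    Module.Finite F (M ⧸ I) ∧ Module.finrank F (M ⧸ I) ≤ Fintype.card ι := by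
  have hfin : Module.Finite F (M ⧸ LinearMap.ker L) :=
    Module.Finite.equiv L.quotKerEquivRange.symm
  have hsurj := Submodule.factor_surjective h
  refine ⟨Module.Finite.of_surjective _ hsurj, ?_⟩
  calc Module.finrank F (M ⧸ I) ≤ Module.finrank F (M ⧸ LinearMap.ker L) :=
        LinearMap.finrank_le_finrank_of_surjective hsurj
    _ = Module.finrank F (LinearMap.range L) := L.quotKerEquivRange.finrank_eq
    _ ≤ Module.finrank F (ι → F) := Submodule.finrank_le _
    _ = Fintype.card ι := Module.finrank_fintype_fun_eq_card F

end Multilinear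

/-! ### Values of monomials in the word algebra -/

section WordAlgebraValues

variable {F : Type*} [Field F] {K : ℕ → ℕ}

namespace WordBasis

/-- Whether a basis element is one of the `z i j`. -/
def isZ : WordBasis K → Bool
  | z _ _ => true
  | _ => false

/-- Whether a basis element is `b`. -/
def isB : WordBasis K → Bool
  | b => true
  | _ => false

/-- The position of a basis element `z i j` (with the junk value `(0, 0)` for `a` and `b`). -/
def pos : WordBasis K → ℕ × ℕ
  | z i j => (i, j)
  | _ => (0, 0)

/-- Two basis elements are both `a`, or both `b`, or both of the form `z i j`, and in the last
case the same letters are read in the `N` steps that follow their positions. -/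
def SameType (N : ℕ) (u v : WordBasis K) : Prop :=
  u.isZ = v.isZ ∧ u.isB = v.isB ∧ (u.isZ = true → posWord K N u.pos = posWord K N v.pos)

lemma SameType.refl (N : ℕ) (u : WordBasis K) : SameType N u u := ⟨rfl, rfl, fun _ => rfl⟩

lemma isB_eq_false_of_isZ {u : WordBasis K} (hu : u.isZ = true) : u.isB = false := by
  cases u with
  | z i j => rfl
  | a => rfl
  | b => exact absurd hu Bool.false_ne_true

lemma eq_b_of_isB {u : WordBasis K} (hu : u.isB = true) : u = b := by
  cases u with
  | b => rfl
  | a => exact absurd hu Bool.false_ne_true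
  | z i j => exact absurd hu Bool.false_ne_true

lemma eq_a {u : WordBasis K} (hz : u.isZ = false) (hb : u.isB = false) : u = a := by
  cases u with
  | a => rfl
  | b => exact absurd hb.symm Bool.false_ne_true
  | z i j => exact absurd hz.symm Bool.false_ne_true

lemma pos_valid {u : WordBasis K} (hu : u.isZ = true) : u.pos.2 < K u.pos.1 := by
  cases u with
  | z i j => exact j.2
  | a => simp [isZ] at hu
  | b => simp [isZ] at hu

end WordBasis

namespace WordAlgebra

variable (F K) in
/-- The basis element at a position of the chain (zero at positions out of range). -/
noncomputable def zAt (p : ℕ × ℕ) : WordAlgebra F K := z F K p.1 p.2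

lemma ofBasis_mul_ofBasis (u v : WordBasis K) :
    ofBasis F K u * ofBasis F K v = mulBasis F K u v := by
  change mulMap F K (ofBasis F K u) (ofBasis F K v) = _
  change ((Finsupp.linearCombination F fun u => (Finsupp.linearCombination F fun v =>
    mulBasis F K u v : (WordBasis K →₀ F) →ₗ[F] WordAlgebra F K)) (Finsupp.single u 1))
    (Finsupp.single v 1) = _
  rw [Finsupp.linearCombination_single, one_smul, Finsupp.linearCombination_single, one_smul]

lemma ofBasis_of_isZ {u : WordBasis K} (hu : u.isZ = true) : ofBasis F K u = zAt F K u.pos := by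
  cases u with
  | z i j => simp [zAt, WordBasis.pos, z]
  | a => simp [WordBasis.isZ] at hu
  | b => simp [WordBasis.isZ] at hu

variable (F K) in
lemma span_ofBasis : Submodule.span F (Set.range (ofBasis F K)) = ⊤ := by
  rw [eq_top_iff]
  intro x _
  induction x using Finsupp.induction_linear with
  | zero => exact Submodule.zero_mem _
  | add f g hf hg => exact Submodule.add_mem _ (hf trivial) (hg trivial)
  | single u c =>
    have h : (Finsupp.single u c : WordBasis K →₀ F) = c • (Finsupp.single u (1 : F)) := by simp
    exact h ▸ Submodule.smul_mem _ c (Submodule.subset_span ⟨u, rfl⟩)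

lemma ofBasis_mul_eq_zero {u : WordBasis K} (hu : u.isZ = false) (x : WordAlgebra F K) :
    ofBasis F K u * x = 0 := by
  have hle : Submodule.span F (Set.range (ofBasis F K)) ≤
      LinearMap.ker (LinearMap.mulLeft F (ofBasis F K u)) := by
    rw [Submodule.span_le]
    rintro _ ⟨v, rfl⟩
    simp only [SetLike.mem_coe, LinearMap.mem_ker, LinearMap.mulLeft_apply, ofBasis_mul_ofBasis]
    cases u with
    | z i j => simp [WordBasis.isZ] at hu
    | a => rfl
    | b => rfl
  have := hle (show x ∈ _ by rw [span_ofBasis]; trivial)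
  simpa using this

lemma zAt_eq_zero {p : ℕ × ℕ} (h : ¬ p.2 < K p.1) : zAt F K p = 0 := by simp [zAt, z, h]

lemma zAt_eq_ofBasis {p : ℕ × ℕ} (h : p.2 < K p.1) :
    zAt F K p = ofBasis F K (WordBasis.z p.1 ⟨p.2, h⟩) := by simp [zAt, z, h]

lemma ofBasis_ne_zero (u : WordBasis K) : ofBasis F K u ≠ 0 := by
  intro h
  have : (Finsupp.single u (1 : F) : WordBasis K →₀ F) = 0 := h
  simp at this

lemma zAt_ne_zero {p : ℕ × ℕ} (h : p.2 < K p.1) : zAt F K p ≠ 0 := by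
  rw [zAt_eq_ofBasis h]
  exact ofBasis_ne_zero _

lemma zAt_mul_a (p : ℕ × ℕ) :
    zAt F K p * ofBasis F K WordBasis.a = if IsBPos K p then 0 else zAt F K (nextPos K p) := by
  by_cases h : p.2 < K p.1
  · rw [zAt_eq_ofBasis h, ofBasis_mul_ofBasis]
    change z F K p.1 (p.2 + 1) = _
    split_ifs with hb
    · unfold IsBPos at hb
      simp [z, hb]
    · simp [nextPos, hb, zAt]
  · have hb : ¬ IsBPos K p := by
      unfold IsBPos
      omega
    rw [zAt_eq_zero h, zero_mul, if_neg hb, nextPos, if_neg hb, zAt_eq_zero]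
    simp only
    omega

lemma zAt_mul_b (p : ℕ × ℕ) :
    zAt F K p * ofBasis F K WordBasis.b = if IsBPos K p then zAt F K (nextPos K p) else 0 := by
  by_cases h : p.2 < K p.1
  · rw [zAt_eq_ofBasis h, ofBasis_mul_ofBasis]
    change (if p.2 + 1 = K p.1 then z F K (p.1 + 1) 0 else 0) = _
    by_cases hb : IsBPos K p
    · rw [if_pos hb, nextPos, if_pos hb, zAt]
      exact if_pos hb
    · rw [if_neg hb]
      exact if_neg hb
  · have hb : ¬ IsBPos K p := by
      unfold IsBPos
      omega
    rw [zAt_eq_zero h, zero_mul, if_neg hb]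

lemma zAt_mul_zAt (p q : ℕ × ℕ) : zAt F K p * zAt F K q = 0 := by
  by_cases hp : p.2 < K p.1
  · by_cases hq : q.2 < K q.1
    · rw [zAt_eq_ofBasis hp, zAt_eq_ofBasis hq, ofBasis_mul_ofBasis]
      rfl
    · rw [zAt_eq_zero hq, mul_zero]
  · rw [zAt_eq_zero hp, zero_mul]

variable {V : Type*}

/-- The value of a monomial `t` under a substitution `χ` of basis elements. Unless it vanishes or
`t` is a single letter, exactly one letter takes a value `z i j`, and the other letters move it
along the chain. The value at a second substitution `ψ` of the same type is obtained in the same way. -/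
lemma lift_monomial_cases {N : ℕ} {χ ψ : V → WordBasis K} (t : FreeMagma V)
    (hcard : Multiset.card t.letters ≤ N + 1)
    (hχ : ∀ v ∈ t.letters, (χ v).SameType N (ψ v)) :
    (FreeMagma.lift (fun v => ofBasis F K (χ v)) t = 0 ∧
      FreeMagma.lift (fun v => ofBasis F K (ψ v)) t = 0) ∨
    (∃ v, t = FreeMagma.of v ∧ (χ v).isZ = false) ∨
    ∃ v ∈ t.letters, (χ v).isZ = true ∧ t.letters.countP (fun v => (χ v).isZ = true) = 1 ∧
      t.letters.countP (fun v => (χ v).isB = true) =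
        bCount K (χ v).pos (Multiset.card t.letters - 1) ∧
      FreeMagma.lift (fun v => ofBasis F K (χ v)) t =
        zAt F K (posAt K (χ v).pos (Multiset.card t.letters - 1)) ∧
      FreeMagma.lift (fun v => ofBasis F K (ψ v)) t =
        zAt F K (posAt K (ψ v).pos (Multiset.card t.letters - 1)) := by
  induction t using FreeMagma.recOnMul with
  | ih1 v =>
    right
    rcases Bool.eq_false_or_eq_true (χ v).isZ with hv | hv
    · have hv' : (ψ v).isZ = true := by
        rw [← (hχ v (by simp [FreeMagma.letters_of])).1, hv]
      right
      refine ⟨v, by simp [FreeMagma.letters_of], hv, ?_, ?_, ?_, ?_⟩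
      · simp [FreeMagma.letters_of, hv, Multiset.countP_eq_card_filter,
          Multiset.filter_singleton]
      · have hb := WordBasis.isB_eq_false_of_isZ hv
        simp [FreeMagma.letters_of, hb, Multiset.countP_eq_card_filter,
          Multiset.filter_singleton, bCount]
      · simp [FreeMagma.letters_of, ofBasis_of_isZ hv, posAt]
      · simp [FreeMagma.letters_of, ofBasis_of_isZ hv', posAt]
    · exact Or.inl ⟨v, rfl, hv⟩
  | ih2 s r hs hr =>
    have hcs := s.card_letters_pos
    have hcr := r.card_letters_pos
    rw [FreeMagma.letters_mul] at hcard hχ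
    rw [Multiset.card_add] at hcard
    specialize hs (by omega) fun v hv => hχ v (by simp [hv])
    specialize hr (by omega) fun v hv => hχ v (by simp [hv])
    rw [map_mul, map_mul]
    rcases hs with ⟨h1, h2⟩ | ⟨v, rfl, hv⟩ | ⟨v, hv, hvz, hcz, hcb, h1, h2⟩
    · left
      rw [h1, h2, zero_mul, zero_mul]
      exact ⟨rfl, rfl⟩
    · left
      have hv' : (ψ v).isZ = false := by
        rw [← (hχ v (by simp [FreeMagma.letters_of])).1, hv]
      rw [FreeMagma.lift_of, FreeMagma.lift_of, ofBasis_mul_eq_zero hv, ofBasis_mul_eq_zero hv']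
      exact ⟨rfl, rfl⟩
    · rcases hr with ⟨h3, h4⟩ | ⟨y, rfl, hy⟩ | ⟨y, hy, hyz, hcyz, hcyb, h3, h4⟩
      · left
        rw [h3, h4, mul_zero, mul_zero]
        exact ⟨rfl, rfl⟩
      · obtain ⟨hst1, hst2, -⟩ := hχ y (by simp [FreeMagma.letters_of])
        have hword := (hχ v (by simp [hv])).2.2 hvz
        simp only [FreeMagma.letters_of, Multiset.card_singleton] at hcard
        have hiff := isBPos_iff_of_posWord_eq hword
          (show Multiset.card s.letters - 1 < N by omega)
        have hc1 : Multiset.card (s * FreeMagma.of y).letters - 1 =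
            Multiset.card s.letters - 1 + 1 := by
          rw [FreeMagma.letters_mul, Multiset.card_add, FreeMagma.letters_of,
            Multiset.card_singleton]
          omega
        have hcz1 : (s * FreeMagma.of y).letters.countP (fun v => (χ v).isZ = true) = 1 := by
          rw [FreeMagma.letters_mul, Multiset.countP_add, hcz]
          simp [FreeMagma.letters_of, hy, Multiset.countP_eq_card_filter,
            Multiset.filter_singleton]
        have hcb1 : (s * FreeMagma.of y).letters.countP (fun v => (χ v).isB = true) =
            bCount K (χ v).pos (Multiset.card s.letters - 1) +
              if (χ y).isB = true then 1 else 0 := by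
          rw [FreeMagma.letters_mul, Multiset.countP_add, hcb]
          simp only [FreeMagma.letters_of, Multiset.countP_eq_card_filter,
            Multiset.filter_singleton]
          split_ifs <;> simp
        rw [h1, h2, FreeMagma.lift_of, FreeMagma.lift_of, hc1, hcb1, hcz1]
        rw [hy] at hst1
        by_cases hyb : (χ y).isB = true
        · have e1 := WordBasis.eq_b_of_isB hyb
          have e2 := WordBasis.eq_b_of_isB (hst2.symm.trans hyb)
          rw [e1, e2, zAt_mul_b, zAt_mul_b]
          by_cases hb : IsBPos K (posAt K (χ v).pos (Multiset.card s.letters - 1))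
          · right; right
            refine ⟨v, by simp [FreeMagma.letters_mul, hv], hvz, rfl, ?_, ?_, ?_⟩
            · rw [bCount_succ, if_pos hb]
              rfl
            · rw [if_pos hb, posAt_succ]
            · rw [if_pos (hiff.mp hb), posAt_succ]
          · left
            rw [if_neg hb, if_neg fun h => hb (hiff.mpr h)]
            exact ⟨rfl, rfl⟩
        · rw [Bool.not_eq_true] at hyb
          have e1 := WordBasis.eq_a hy hyb
          have e2 := WordBasis.eq_a hst1.symm (hst2.symm.trans hyb)
          rw [e1, e2, zAt_mul_a, zAt_mul_a]
          by_cases hb : IsBPos K (posAt K (χ v).pos (Multiset.card s.letters - 1))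
          · left
            rw [if_pos hb, if_pos (hiff.mp hb)]
            exact ⟨rfl, rfl⟩
          · right; right
            refine ⟨v, by simp [FreeMagma.letters_mul, hv], hvz, rfl, ?_, ?_, ?_⟩
            · rw [bCount_succ, if_neg hb]
              rfl
            · rw [if_neg hb, posAt_succ]
            · rw [if_neg fun h => hb (hiff.mpr h), posAt_succ]
      · left
        rw [h1, h2, h3, h4, zAt_mul_zAt, zAt_mul_zAt]
        exact ⟨rfl, rfl⟩

end WordAlgebra

end WordAlgebraValues

/-! ### Bounds for the codimensions of the word algebra -/

section CodimBounds

variable {F : Type*} [Field F] {K : ℕ → ℕ} {V : Type*}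

namespace WordAlgebra

/-- The values of a monomial that is multilinear in the `N + 1 ≥ 2` variables from `S`. -/
lemma lift_multilinear_cases {N : ℕ} (hN : 1 ≤ N) {S : Finset V} (hS : S.card = N + 1)
    {χ ψ : V → WordBasis K} (hχ : ∀ v ∈ S, (χ v).SameType N (ψ v))
    {t : FreeMagma V} (ht : t.letters = S.val) :
    (FreeMagma.lift (fun v => ofBasis F K (χ v)) t = 0 ∧
      FreeMagma.lift (fun v => ofBasis F K (ψ v)) t = 0) ∨
    ∃ i ∈ S, (χ i).isZ = true ∧ (∀ v ∈ S, (χ v).isZ = true → v = i) ∧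
      (S.filter fun v => (χ v).isB = true).card = bCount K (χ i).pos N ∧
      FreeMagma.lift (fun v => ofBasis F K (χ v)) t = zAt F K (posAt K (χ i).pos N) ∧
      FreeMagma.lift (fun v => ofBasis F K (ψ v)) t = zAt F K (posAt K (ψ i).pos N) := by
  have hc : Multiset.card t.letters = N + 1 := by rw [ht]; exact hS
  rcases lift_monomial_cases (F := F) t hc.le (fun v hv => hχ v (by rwa [ht] at hv)) with
    h | ⟨v, rfl, -⟩ | ⟨i, hi, hiz, hcz, hcb, h1, h2⟩
  · exact Or.inl h
  · rw [FreeMagma.letters_of, Multiset.card_singleton] at hc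
    omega
  · right
    rw [hc, Nat.add_sub_cancel] at hcb h1 h2
    rw [ht] at hi hcz hcb
    refine ⟨i, hi, hiz, ?_, ?_, h1, h2⟩
    · intro v hv hvz
      have h : (S.filter fun v => (χ v).isZ = true).card = 1 := by
        rw [← hcz, Multiset.countP_eq_card_filter]
        rfl
      exact Finset.card_le_one.mp h.le v (by simp [hv, hvz]) i
        (Finset.mem_filter.mpr ⟨hi, hiz⟩)
    · rw [← hcb, Multiset.countP_eq_card_filter]
      rfl

/-- A substitution of basis elements under which some multilinear polynomial does not vanish sends
exactly one variable to a `z`, and the right number of variables to `b`. -/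
lemma exists_of_lift_ne_zero {N : ℕ} (hN : 1 ≤ N) {S : Finset V} (hS : S.card = N + 1)
    (χ : V → WordBasis K) {f : FreeNonUnitalNonAssocAlgebra F V} (hf : f ∈ multilinearPolys F S)
    (hne : FreeNonUnitalNonAssocAlgebra.lift F (fun v => ofBasis F K (χ v)) f ≠ 0) :
    ∃ i ∈ S, (χ i).isZ = true ∧ (∀ v ∈ S, (χ v).isZ = true → v = i) ∧
      (S.filter fun v => (χ v).isB = true).card = bCount K (χ i).pos N := by
  by_contra hcon
  apply hne
  induction hf using Submodule.span_induction with
  | mem x hx =>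
    obtain ⟨t, ht, rfl⟩ := hx
    rw [FreeNonUnitalNonAssocAlgebra.lift_single_one]
    rcases lift_multilinear_cases (F := F) hN hS
      (fun v _ => WordBasis.SameType.refl N (χ v)) ht with ⟨h, -⟩ | ⟨i, h1, h2, h3, h4, -, -⟩
    · exact h
    · exact absurd ⟨i, h1, h2, h3, h4⟩ hcon
  | zero => simp
  | add x y _ _ hx hy =>
    by_cases h1 : FreeNonUnitalNonAssocAlgebra.lift F (fun v => ofBasis F K (χ v)) x = 0 <;>
    by_cases h2 : FreeNonUnitalNonAssocAlgebra.lift F (fun v => ofBasis F K (χ v)) y = 0 <;>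
    simp_all
  | smul c x _ hx =>
    by_cases h1 : FreeNonUnitalNonAssocAlgebra.lift F (fun v => ofBasis F K (χ v)) x = 0 <;>
    simp_all

/-- Two substitutions of the same type give the same multiple of a `z`. -/
lemma exists_lift_eq_smul {N : ℕ} (hN : 1 ≤ N) {S : Finset V} (hS : S.card = N + 1)
    {χ ψ : V → WordBasis K} (hχ : ∀ v ∈ S, (χ v).SameType N (ψ v)) {i : V}
    (hi : ∀ v ∈ S, (χ v).isZ = true → v = i)
    {f : FreeNonUnitalNonAssocAlgebra F V} (hf : f ∈ multilinearPolys F S) :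
    ∃ c : F,
      FreeNonUnitalNonAssocAlgebra.lift F (fun v => ofBasis F K (χ v)) f =
        c • zAt F K (posAt K (χ i).pos N) ∧
      FreeNonUnitalNonAssocAlgebra.lift F (fun v => ofBasis F K (ψ v)) f =
        c • zAt F K (posAt K (ψ i).pos N) := by
  induction hf using Submodule.span_induction with
  | mem x hx =>
    obtain ⟨t, ht, rfl⟩ := hx
    rw [FreeNonUnitalNonAssocAlgebra.lift_single_one, FreeNonUnitalNonAssocAlgebra.lift_single_one]
    rcases lift_multilinear_cases (F := F) hN hS hχ ht with
      ⟨h1, h2⟩ | ⟨j, hj, hjz, -, -, h1, h2⟩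
    · exact ⟨0, by simp [h1], by simp [h2]⟩
    · obtain rfl := hi j hj hjz
      exact ⟨1, by rw [h1, one_smul], by rw [h2, one_smul]⟩
  | zero => exact ⟨0, by simp, by simp⟩
  | add x y _ _ hx hy =>
    obtain ⟨c, h1, h2⟩ := hx
    obtain ⟨d, h3, h4⟩ := hy
    exact ⟨c + d, by rw [map_add, h1, h3, add_smul], by rw [map_add, h2, h4, add_smul]⟩
  | smul c x _ hx =>
    obtain ⟨d, h1, h2⟩ := hx
    exact ⟨c * d, by rw [map_smul, h1, mul_smul], by rw [map_smul, h2, mul_smul]⟩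

/-- The substitution that sends `i` to `ζ`, the variables from `B` to `b`, and the others to `a`. -/
def stdSubst [DecidableEq V] (i : V) (B : Finset V) (ζ : WordBasis K) (v : V) : WordBasis K :=
  if v = i then ζ else if v ∈ B then WordBasis.b else WordBasis.a

/-- A basis element `z i j` from which a given word is read (and `a` if there is none). -/
noncomputable def wordRep (K : ℕ → ℕ) {N : ℕ} (u : Fin N → Bool) : WordBasis K :=
  open Classical in
  if h : ∃ ζ : WordBasis K, ζ.isZ = true ∧ posWord K N ζ.pos = u then h.choose else WordBasis.a

lemma wordRep_spec {N : ℕ} {ζ : WordBasis K} (hζ : ζ.isZ = true) :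
    (wordRep K (posWord K N ζ.pos)).isZ = true ∧
      posWord K N (wordRep K (posWord K N ζ.pos)).pos = posWord K N ζ.pos := by
  have h : ∃ ξ : WordBasis K, ξ.isZ = true ∧ posWord K N ξ.pos = posWord K N ζ.pos :=
    ⟨ζ, hζ, rfl⟩
  rw [wordRep, dif_pos h]
  exact h.choose_spec

lemma sameType_stdSubst [DecidableEq V] {N : ℕ} {S : Finset V} {χ : V → WordBasis K} {i : V}
    (hiz : (χ i).isZ = true) (hi : ∀ v ∈ S, (χ v).isZ = true → v = i) {v : V} (hv : v ∈ S) :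
    (χ v).SameType N (stdSubst i (S.filter fun v => (χ v).isB = true)
      (wordRep K (posWord K N (χ i).pos)) v) := by
  obtain ⟨h1, h2⟩ := wordRep_spec (N := N) hiz
  unfold stdSubst
  by_cases hvi : v = i
  · subst hvi
    rw [if_pos rfl]
    exact ⟨hiz.trans h1.symm, by
      rw [WordBasis.isB_eq_false_of_isZ hiz, WordBasis.isB_eq_false_of_isZ h1], fun _ => h2.symm⟩
  · have hvz : (χ v).isZ = false := by
      rw [← Bool.not_eq_true]
      exact fun h => hvi (hi v hv h)
    rw [if_neg hvi]
    by_cases hvb : (χ v).isB = true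
    · rw [if_pos (show v ∈ S.filter fun v => (χ v).isB = true from Finset.mem_filter.mpr ⟨hv, hvb⟩),
        WordBasis.eq_b_of_isB hvb]
      exact WordBasis.SameType.refl _ _
    · rw [if_neg (show v ∉ S.filter fun v => (χ v).isB = true from
        fun h => hvb (Finset.mem_filter.mp h).2), WordBasis.eq_a hvz (Bool.not_eq_true _ ▸ hvb)]
      exact WordBasis.SameType.refl _ _

/-- The sum of the coordinates of an element of the word algebra. -/
noncomputable def coordSum (F : Type*) [Field F] (K : ℕ → ℕ) : WordAlgebra F K →ₗ[F] F :=
  show (WordBasis K →₀ F) →ₗ[F] F from Finsupp.linearCombination F fun _ => (1 : F)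

lemma coordSum_zAt {p : ℕ × ℕ} (hp : p.2 < K p.1) : coordSum F K (zAt F K p) = 1 := by
  rw [zAt_eq_ofBasis hp]
  change Finsupp.linearCombination F (fun _ => (1 : F)) (Finsupp.single _ (1 : F)) = 1
  rw [Finsupp.linearCombination_single, one_smul]

/-- Upper bound for codimensions. The value of a multilinear polynomial at a substitution of basis
elements is determined by the variable `i` sent to a `z`, the set `B` of variables sent to `b`, and
the word that is read from that `z`; so the codimension is at most the number of admissible triples
of this kind. Here `X v` is the set of basis elements allowed as values of `v`. -/
lemma finrank_le_card_triples [DecidableEq V] (hK : ∀ i, 0 < K i) {N : ℕ} (hN : 1 ≤ N)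
    {S : Finset V} (hS : S.card = N + 1) (X : V → Set (WordBasis K))
    {E : Set (V → WordAlgebra F K)}
    (hE : ∀ φ ∈ E, ∀ v ∈ S, φ v ∈ Submodule.span F (ofBasis F K '' X v))
    (J : Finset (V × Finset V × (Fin N → Bool)))
    (hJ : ∀ i ∈ S, ∀ B ⊆ S.erase i, ∀ p : ℕ × ℕ, p.2 < K p.1 → B.card = bCount K p N →
      (∀ v ∈ B, WordBasis.b ∈ X v) → (∀ v ∈ S.erase i, v ∉ B → WordBasis.a ∈ X v) →
      (i, B, posWord K N p) ∈ J) :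
    Module.Finite F (multilinearPolys F S ⧸
        (vanishingPolys F (WordAlgebra F K) E).comap (multilinearPolys F S).subtype) ∧
      Module.finrank F (multilinearPolys F S ⧸
        (vanishingPolys F (WordAlgebra F K) E).comap (multilinearPolys F S).subtype) ≤ J.card := by
  let T : J → (FreeNonUnitalNonAssocAlgebra F V →ₗ[F] F) := fun j =>
    coordSum F K ∘ₗ (FreeNonUnitalNonAssocAlgebra.lift F
      (fun v => ofBasis F K (stdSubst j.1.1 j.1.2.1 (wordRep K j.1.2.2) v)) :
        FreeNonUnitalNonAssocAlgebra F V →ₗ[F] WordAlgebra F K)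
  let L : multilinearPolys F S →ₗ[F] (J → F) :=
    LinearMap.pi fun j => T j ∘ₗ (multilinearPolys F S).subtype
  have hker : LinearMap.ker L ≤
      (vanishingPolys F (WordAlgebra F K) E).comap (multilinearPolys F S).subtype := by
    rintro ⟨f, hf⟩ hfL φ hφ
    refine multilinearPolys_lift_eq_zero_of_span hf (fun v => ofBasis F K '' X v) ?_ φ (hE φ hφ)
    intro φ' hφ'
    have hch : ∀ v, ∃ u : WordBasis K, v ∈ S → u ∈ X v ∧ φ' v = ofBasis F K u := by
      intro v
      by_cases hv : v ∈ S
      · obtain ⟨u, hu, h⟩ := hφ' v hv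
        exact ⟨u, fun _ => ⟨hu, h.symm⟩⟩
      · exact ⟨WordBasis.a, fun h => absurd h hv⟩
    choose χ hχ using hch
    rw [multilinearPolys_lift_congr hf (fun v hv => (hχ v hv).2)]
    by_contra hne
    obtain ⟨i, hiS, hiz, hi, hcard⟩ := exists_of_lift_ne_zero hN hS χ hf hne
    have hmem : (i, S.filter (fun v => (χ v).isB = true), posWord K N (χ i).pos) ∈ J := by
      refine hJ i hiS _ ?_ _ (WordBasis.pos_valid hiz) hcard ?_ ?_
      · intro v hv
        obtain ⟨hv1, hv2⟩ := Finset.mem_filter.mp hv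
        refine Finset.mem_erase.mpr ⟨?_, hv1⟩
        rintro rfl
        rw [WordBasis.isB_eq_false_of_isZ hiz] at hv2
        exact Bool.false_ne_true hv2
      · intro v hv
        obtain ⟨hv1, hv2⟩ := Finset.mem_filter.mp hv
        exact WordBasis.eq_b_of_isB hv2 ▸ (hχ v hv1).1
      · intro v hv hvB
        obtain ⟨hvi, hvS⟩ := Finset.mem_erase.mp hv
        have hvz : (χ v).isZ = false := by
          rw [← Bool.not_eq_true]
          exact fun h => hvi (hi v hvS h)
        have hvb : (χ v).isB = false := by
          rw [← Bool.not_eq_true]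
          exact fun h => hvB (Finset.mem_filter.mpr ⟨hvS, h⟩)
        exact WordBasis.eq_a hvz hvb ▸ (hχ v hvS).1
    obtain ⟨c, h1, h2⟩ := exists_lift_eq_smul hN hS
      (fun v hv => sameType_stdSubst (N := N) hiz hi hv) hi hf
    have hTz : T ⟨_, hmem⟩ f = 0 := congrFun (LinearMap.mem_ker.mp hfL) ⟨_, hmem⟩
    have hTc : T ⟨_, hmem⟩ f = c := by
      change coordSum F K (FreeNonUnitalNonAssocAlgebra.lift F _ f) = c
      rw [h2, map_smul, coordSum_zAt, smul_eq_mul, mul_one]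
      refine posAt_valid hK (WordBasis.pos_valid ?_) N
      rw [stdSubst, if_pos rfl]
      exact (wordRep_spec hiz).1
    rw [← hTc, hTz, zero_smul] at h1
    exact hne h1
  obtain ⟨hfin, hle⟩ := finrank_quotient_le_of_ker_le L hker
  exact ⟨hfin, by rwa [Fintype.card_coe] at hle⟩

/-- Given a set `B` of variables of the right size, there is a monomial in which the variables from
`B` occupy the places where the chain started at `p` requires the letter `b`; it vanishes
under the substitutions belonging to other sets. -/
lemma exists_monomial [DecidableEq V] {i : V} {ζ : WordBasis K} (hζ : ζ.isZ = true) (n : ℕ)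
    (B C : Finset V) (hiB : i ∉ B) (hiC : i ∉ C)
    (hB : B.card = bCount K ζ.pos n) (hn : B.card + C.card = n) :
    ∃ t : FreeMagma V, t.letters = i ::ₘ (B.val + C.val) ∧ ∀ B' : Finset V,
      FreeMagma.lift (fun v => ofBasis F K (stdSubst i B' ζ v)) t =
        if (∀ v ∈ B, v ∈ B') ∧ (∀ v ∈ C, v ∉ B') then zAt F K (posAt K ζ.pos n) else 0 := by
  induction n generalizing B C with
  | zero =>
    obtain rfl : B = ∅ := Finset.card_eq_zero.mp (by omega)
    obtain rfl : C = ∅ := Finset.card_eq_zero.mp (by omega)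
    refine ⟨FreeMagma.of i, by simp [FreeMagma.letters_of], fun B' => ?_⟩
    simp [stdSubst, ofBasis_of_isZ hζ, posAt]
  | succ n ih =>
    rw [bCount_succ] at hB
    by_cases hb : IsBPos K (posAt K ζ.pos n)
    · rw [if_pos hb] at hB
      obtain ⟨v, hv⟩ := Finset.card_pos.mp (show 0 < B.card by omega)
      have hc := Finset.card_erase_of_mem hv
      obtain ⟨t, ht, hval⟩ := ih (B.erase v) C
        (fun h => hiB (Finset.mem_of_mem_erase h)) hiC (by omega) (by omega)
      refine ⟨t * FreeMagma.of v, ?_, fun B' => ?_⟩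
      · rw [FreeMagma.letters_mul, ht, FreeMagma.letters_of, Finset.erase_val,
          Multiset.cons_add, add_right_comm, add_comm (B.val.erase v),
          Multiset.singleton_add, Multiset.cons_erase hv]
      · have hvi : v ≠ i := fun h => hiB (h ▸ hv)
        rw [map_mul, hval, FreeMagma.lift_of, stdSubst, if_neg hvi]
        by_cases hvB' : v ∈ B'
        · have hiff : ((∀ y ∈ B.erase v, y ∈ B') ∧ ∀ y ∈ C, y ∉ B') ↔
              ((∀ y ∈ B, y ∈ B') ∧ ∀ y ∈ C, y ∉ B') := by
            refine and_congr_left fun _ => ⟨fun h y hy => ?_,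
              fun h y hy => h y (Finset.mem_of_mem_erase hy)⟩
            by_cases hyv : y = v
            · exact hyv ▸ hvB'
            · exact h y (Finset.mem_erase.mpr ⟨hyv, hy⟩)
          rw [if_pos hvB', ite_mul, zero_mul, zAt_mul_b, if_pos hb, posAt_succ]
          simp only [hiff]
        · rw [if_neg hvB', ite_mul, zero_mul, zAt_mul_a, if_pos hb, ite_self,
            if_neg fun h => hvB' (h.1 v hv)]
    · rw [if_neg hb, Nat.add_zero] at hB
      have hle := bCount_le (K := K) ζ.pos n
      obtain ⟨v, hv⟩ := Finset.card_pos.mp (show 0 < C.card by omega)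
      have hc := Finset.card_erase_of_mem hv
      obtain ⟨t, ht, hval⟩ := ih B (C.erase v)
        hiB (fun h => hiC (Finset.mem_of_mem_erase h)) (by omega) (by omega)
      refine ⟨t * FreeMagma.of v, ?_, fun B' => ?_⟩
      · rw [FreeMagma.letters_mul, ht, FreeMagma.letters_of, Finset.erase_val,
          Multiset.cons_add, add_assoc, add_comm (C.val.erase v),
          Multiset.singleton_add, Multiset.cons_erase hv]
      · have hvi : v ≠ i := fun h => hiC (h ▸ hv)
        rw [map_mul, hval, FreeMagma.lift_of, stdSubst, if_neg hvi]
        by_cases hvB' : v ∈ B'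
        · rw [if_pos hvB', ite_mul, zero_mul, zAt_mul_b, if_neg hb, ite_self,
            if_neg fun h => h.2 v hv hvB']
        · have hiff : ((∀ y ∈ B, y ∈ B') ∧ ∀ y ∈ C.erase v, y ∉ B') ↔
              ((∀ y ∈ B, y ∈ B') ∧ ∀ y ∈ C, y ∉ B') := by
            refine and_congr_right fun _ => ⟨fun h y hy => ?_,
              fun h y hy => h y (Finset.mem_of_mem_erase hy)⟩
            by_cases hyv : y = v
            · exact hyv ▸ hvB'
            · exact h y (Finset.mem_erase.mpr ⟨hyv, hy⟩)
          rw [if_neg hvB', ite_mul, zero_mul, zAt_mul_a, if_neg hb, posAt_succ]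
          simp only [hiff]

/-- Lower bound for codimensions: the monomials of `exists_monomial` are linearly independent modulo
the identities. -/
lemma card_le_finrank [DecidableEq V] (hK : ∀ i, 0 < K i) {N : ℕ} (hN : 1 ≤ N)
    {S : Finset V} (hS : S.card = N + 1) {E : Set (V → WordAlgebra F K)} {i : V} (hi : i ∈ S)
    {ζ : WordBasis K} (hζ : ζ.isZ = true) (ℬ : Finset (Finset V))
    (hsub : ∀ B ∈ ℬ, B ⊆ S.erase i) (hcard : ∀ B ∈ ℬ, B.card = bCount K ζ.pos N)
    (hE : ∀ B ∈ ℬ, ∃ φ ∈ E, ∀ v ∈ S, φ v = ofBasis F K (stdSubst i B ζ v)) :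
    ℬ.card ≤ Module.finrank F (multilinearPolys F S ⧸
        (vanishingPolys F (WordAlgebra F K) E).comap (multilinearPolys F S).subtype) := by
  set I := (vanishingPolys F (WordAlgebra F K) E).comap (multilinearPolys F S).subtype with hI
  have hfin : Module.Finite F (multilinearPolys F S ⧸ I) := by
    refine (finrank_le_card_triples hK hN hS (fun _ => Set.univ) ?_
      (S ×ˢ S.powerset ×ˢ Finset.univ) ?_).1
    · intro φ _ v _
      rw [Set.image_univ, span_ofBasis]
      trivial
    · intro j hj B hB p _ _ _ _
      simp only [Finset.mem_product, Finset.mem_powerset, Finset.mem_univ, and_true]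
      exact ⟨hj, hB.trans (Finset.erase_subset _ _)⟩
  have hex : ∀ B : ℬ, ∃ t : FreeMagma V, t.letters = S.val ∧ ∀ B' : ℬ,
      FreeMagma.lift (fun v => ofBasis F K (stdSubst i B'.1 ζ v)) t =
        if B' = B then zAt F K (posAt K ζ.pos N) else 0 := by
    rintro ⟨B, hB⟩
    have hBsub := hsub B hB
    have hcS := Finset.card_erase_of_mem hi
    have hcd := Finset.card_sdiff_add_card_eq_card hBsub
    obtain ⟨t, ht, hval⟩ := exists_monomial (F := F) (i := i) hζ N B (S.erase i \ B)
      (fun h => (Finset.mem_erase.mp (hBsub h)).1 rfl)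
      (fun h => (Finset.mem_erase.mp (Finset.mem_sdiff.mp h).1).1 rfl) (hcard B hB) (by omega)
    refine ⟨t, ?_, ?_⟩
    · have h1 : B.val + (S.erase i \ B).val = (S.erase i).val := by
        rw [Finset.sdiff_val, add_tsub_cancel_of_le (Finset.val_le_iff.mpr hBsub)]
      rw [ht, h1, Finset.erase_val, Multiset.cons_erase hi]
    · rintro ⟨B', hB'⟩
      rw [hval B']
      have hB'sub := hsub B' hB'
      congr 1
      rw [eq_iff_iff]
      constructor
      · rintro ⟨h1, h2⟩
        apply Subtype.ext
        refine Finset.Subset.antisymm (fun v hv => ?_) h1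
        by_contra hvB
        exact h2 v (Finset.mem_sdiff.mpr ⟨hB'sub hv, hvB⟩) hv
      · intro h
        obtain rfl : B' = B := congrArg Subtype.val h
        exact ⟨fun v hv => hv, fun v hv => (Finset.mem_sdiff.mp hv).2⟩
  choose t ht hval using hex
  let mono : ℬ → multilinearPolys F S := fun B =>
    ⟨MonoidAlgebra.single (t B) (1 : F), Submodule.subset_span ⟨t B, ht B, rfl⟩⟩
  have hvalid : (posAt K ζ.pos N).2 < K (posAt K ζ.pos N).1 :=
    posAt_valid hK (WordBasis.pos_valid hζ) N
  have hli : LinearIndependent F fun B => Submodule.Quotient.mk (p := I) (mono B) := by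
    rw [Fintype.linearIndependent_iff]
    intro c hc B
    have hsum : Submodule.Quotient.mk (p := I) (∑ B, c B • mono B) = 0 := by
      rw [← hc, ← Submodule.mkQ_apply, map_sum]
      simp
    rw [Submodule.Quotient.mk_eq_zero, hI, Submodule.mem_comap] at hsum
    obtain ⟨φ, hφE, hφ⟩ := hE B.1 B.2
    have h0 := hsum φ hφE
    rw [Submodule.subtype_apply, multilinearPolys_lift_congr (∑ B, c B • mono B).2 hφ,
      ← Submodule.subtype_apply] at h0
    have h1 : FreeNonUnitalNonAssocAlgebra.lift F (fun v => ofBasis F K (stdSubst i B.1 ζ v))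
        ((multilinearPolys F S).subtype (∑ B, c B • mono B)) =
          c B • zAt F K (posAt K ζ.pos N) := by
      rw [map_sum, map_sum, Finset.sum_eq_single B]
      · rw [map_smul, map_smul, Submodule.subtype_apply,
          FreeNonUnitalNonAssocAlgebra.lift_single_one, hval, if_pos rfl]
      · intro B' _ hne
        rw [map_smul, map_smul, Submodule.subtype_apply,
          FreeNonUnitalNonAssocAlgebra.lift_single_one, hval, if_neg hne.symm, smul_zero]
      · intro h
        exact absurd (Finset.mem_univ _) h
    rw [h1] at h0
    exact (smul_eq_zero.mp h0).resolve_right (zAt_ne_zero hvalid)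
  have := hli.fintype_card_le_finrank
  rwa [Fintype.card_coe] at this

end WordAlgebra

end CodimBounds

/-! ### The exponents -/

section Exponents

variable {F : Type*} [Field F] {K : ℕ → ℕ}

namespace WordAlgebra

lemma bCount_wordRep {N : ℕ} {p : ℕ × ℕ} (hp : p.2 < K p.1) :
    bCount K (wordRep K (posWord K N p)).pos N = bCount K p N :=
  bCount_eq_of_posWord_eq (wordRep_spec (ζ := WordBasis.z p.1 ⟨p.2, hp⟩) rfl).2 le_rfl

lemma codim_le (hK : ∀ i, 0 < K i) {N : ℕ} (hN : 1 ≤ N) {M : ℕ}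
    (hM : ∀ p : ℕ × ℕ, p.2 < K p.1 → N.choose (bCount K p N) ≤ M) :
    codim F (WordAlgebra F K) (N + 1) ≤ (N + 1) * (posWords K N).card * M := by
  let S := Finset.range (N + 1)
  let J : Finset (ℕ × Finset ℕ × (Fin N → Bool)) := (S ×ˢ posWords K N).biUnion fun x =>
    (Finset.powersetCard (bCount K (wordRep K x.2).pos N) (S.erase x.1)).image
      fun B => (x.1, B, x.2)
  refine (finrank_le_card_triples hK hN (S := S) (by simp [S]) (fun _ => Set.univ) ?_ J ?_).2.trans
    ?_
  · intro φ _ v _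
    rw [Set.image_univ, span_ofBasis]
    trivial
  · intro i hi B hB p hp hcard _ _
    refine Finset.mem_biUnion.mpr ⟨(i, posWord K N p), ?_, ?_⟩
    · exact Finset.mem_product.mpr ⟨hi, mem_posWords.mpr ⟨p, hp, rfl⟩⟩
    · refine Finset.mem_image.mpr ⟨B, Finset.mem_powersetCard.mpr ⟨hB, ?_⟩, rfl⟩
      rw [hcard, bCount_wordRep hp]
  · have hcard : (N + 1) * (posWords K N).card = (S ×ˢ posWords K N).card := by
      simp [S, Finset.card_product]
    rw [hcard]
    refine Finset.card_biUnion_le_card_mul _ _ _ fun x hx => ?_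
    obtain ⟨hx1, hx2⟩ := Finset.mem_product.mp hx
    obtain ⟨p, hp, hpx⟩ := mem_posWords.mp hx2
    refine Finset.card_image_le.trans ?_
    rw [Finset.card_powersetCard, Finset.card_erase_of_mem hx1, Finset.card_range,
      Nat.add_sub_cancel, ← hpx, bCount_wordRep hp]
    exact hM p hp

lemma choose_le_codim (hK : ∀ i, 0 < K i) {N : ℕ} (hN : 1 ≤ N) :
    N.choose (bCount K (0, 0) N) ≤ codim F (WordAlgebra F K) (N + 1) := by
  have h0 : 0 ∈ Finset.range (N + 1) := by simp
  have h := card_le_finrank (F := F) hK hN (S := Finset.range (N + 1)) (by simp)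
    (E := Set.univ) h0 (ζ := WordBasis.z 0 ⟨0, hK 0⟩) rfl
    (Finset.powersetCard (bCount K (0, 0) N) ((Finset.range (N + 1)).erase 0))
    (fun B hB => (Finset.mem_powersetCard.mp hB).1)
    (fun B hB => (Finset.mem_powersetCard.mp hB).2) (fun B _ => ⟨_, trivial, fun _ _ => rfl⟩)
  rwa [Finset.card_powersetCard, Finset.card_erase_of_mem h0, Finset.card_range,
    Nat.add_sub_cancel] at h

/-- The degree of a basis element in a grading with `a` and `z 0 0` even and `b` odd. -/
def basisDegree : WordBasis K → ZMod 2
  | WordBasis.a => 0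
  | WordBasis.b => 1
  | WordBasis.z i _ => i

section Graded

variable {𝒜 : ZMod 2 → Submodule F (WordAlgebra F K)}

lemma ofBasis_mem_graded (hK : ∀ i, 0 < K i) (h_mul : SetLike.GradedMul 𝒜)
    (ha : a F K ∈ 𝒜 0) (hz : z F K 0 0 ∈ 𝒜 0) (hb : b F K ∈ 𝒜 1) (u : WordBasis K) :
    ofBasis F K u ∈ 𝒜 (basisDegree u) := by
  have hzi : ∀ i j, j < K i → zAt F K (i, j) ∈ 𝒜 (i : ZMod 2) := by
    intro i
    induction i with
    | zero =>
      intro j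
      induction j with
      | zero => exact fun _ => by simpa [zAt] using hz
      | succ j ih =>
        intro hj
        have hmul := h_mul.mul_mem (ih (by omega)) ha
        have hnb : ¬ IsBPos K (0, j) := by simp only [IsBPos]; omega
        change zAt F K (0, j) * ofBasis F K WordBasis.a ∈ _ at hmul
        rwa [zAt_mul_a, if_neg hnb, nextPos, if_neg hnb, add_zero] at hmul
    | succ i ihi =>
      intro j
      induction j with
      | zero =>
        intro _
        have hKi := hK i
        have hmul := h_mul.mul_mem (ihi (K i - 1) (by omega)) hb
        have hbp : IsBPos K (i, K i - 1) := by simp only [IsBPos]; omega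
        change zAt F K (i, K i - 1) * ofBasis F K WordBasis.b ∈ _ at hmul
        rw [zAt_mul_b, if_pos hbp, nextPos, if_pos hbp] at hmul
        exact_mod_cast hmul
      | succ j ih =>
        intro hj
        have hmul := h_mul.mul_mem (ih (by omega)) ha
        have hnb : ¬ IsBPos K (i + 1, j) := by simp only [IsBPos]; omega
        change zAt F K (i + 1, j) * ofBasis F K WordBasis.a ∈ _ at hmul
        rwa [zAt_mul_a, if_neg hnb, nextPos, if_neg hnb, add_zero] at hmul
  cases u with
  | a => exact ha
  | b => exact hb
  | z i j =>
    have := hzi i j j.2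
    rwa [zAt_eq_ofBasis (p := (i, (j : ℕ))) j.2] at this

/-- The homogeneous components are spanned by basis elements. -/
lemma graded_le_span (hK : ∀ i, 0 < K i) (h_internal : DirectSum.IsInternal 𝒜)
    (h_mul : SetLike.GradedMul 𝒜)
    (ha : a F K ∈ 𝒜 0) (hz : z F K 0 0 ∈ 𝒜 0) (hb : b F K ∈ 𝒜 1) (d : ZMod 2) :
    𝒜 d ≤ Submodule.span F (ofBasis F K '' {u | basisDegree u = d}) := by
  have hle : ∀ e, Submodule.span F (ofBasis F K '' {u | basisDegree u = e}) ≤ 𝒜 e := by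
    intro e
    rw [Submodule.span_le]
    rintro _ ⟨u, rfl, rfl⟩
    exact ofBasis_mem_graded hK h_mul ha hz hb u
  intro x hx
  have hxtop : x ∈ Submodule.span F (ofBasis F K '' {u | basisDegree u = d}) ⊔
      Submodule.span F (ofBasis F K '' {u | basisDegree u = d + 1}) := by
    rw [← Submodule.span_union, ← Set.image_union]
    have huniv : {u : WordBasis K | basisDegree u = d} ∪ {u | basisDegree u = d + 1} =
        Set.univ := by
      have h2 : ∀ e d : ZMod 2, e = d ∨ e = d + 1 := by decide
      exact Set.eq_univ_of_forall fun u => h2 _ _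
    rw [huniv, Set.image_univ, span_ofBasis]
    trivial
  obtain ⟨y, hy, y', hy', rfl⟩ := Submodule.mem_sup.mp hxtop
  have hne : ∀ e : ZMod 2, e ≠ e + 1 := by decide
  have hdisj := h_internal.submodule_iSupIndep.pairwiseDisjoint (hne d)
  have hy'd : y' ∈ 𝒜 d := by
    have := (𝒜 d).sub_mem hx (hle d hy)
    rwa [add_sub_cancel_left] at this
  have hy0 := (Submodule.disjoint_def.mp hdisj) y' hy'd (hle _ hy')
  rwa [hy0, add_zero]

/-- If a `z` is substituted for one variable, then the set of variables that take the value `b` is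
forced: they are the remaining odd ones. -/
lemma partialCodim_le (hK : ∀ i, 0 < K i) (h_internal : DirectSum.IsInternal 𝒜)
    (h_mul : SetLike.GradedMul 𝒜)
    (ha : a F K ∈ 𝒜 0) (hz : z F K 0 0 ∈ 𝒜 0) (hb : b F K ∈ 𝒜 1) {N k l : ℕ} (hN : 1 ≤ N)
    (hkl : k + l = N + 1) :
    partialCodim 𝒜 k l ≤ (N + 1) * (posWords K N).card ∧
      (partialCodim 𝒜 k l ≠ 0 → ∃ p : ℕ × ℕ, p.2 < K p.1 ∧ ∃ e ≤ 1, l = bCount K p N + e) := by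
  let S : Finset (ℕ ⊕ ℕ) := (Finset.range k).disjSum (Finset.range l)
  have hS : S.card = N + 1 := by simp [S, hkl]
  let odd : Finset (ℕ ⊕ ℕ) := (Finset.range l).map Function.Embedding.inr
  let X : ℕ ⊕ ℕ → Set (WordBasis K) := fun v =>
    {u | basisDegree u = v.elim (fun _ => 0) fun _ => 1}
  have hE : ∀ φ ∈ {φ : ℕ ⊕ ℕ → WordAlgebra F K |
      (∀ i, φ (Sum.inl i) ∈ 𝒜 0) ∧ (∀ i, φ (Sum.inr i) ∈ 𝒜 1)},
      ∀ v ∈ S, φ v ∈ Submodule.span F (ofBasis F K '' X v) := by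
    rintro φ ⟨h0, h1⟩ (v | v) _
    · exact graded_le_span hK h_internal h_mul ha hz hb 0 (h0 v)
    · exact graded_le_span hK h_internal h_mul ha hz hb 1 (h1 v)
  have hforced : ∀ i ∈ S, ∀ B ⊆ S.erase i, (∀ v ∈ B, WordBasis.b ∈ X v) →
      (∀ v ∈ S.erase i, v ∉ B → WordBasis.a ∈ X v) → B = odd.erase i := by
    intro i _ B hB h1 h2
    have h10 : (1 : ZMod 2) ≠ 0 := by decide
    have h01 : (0 : ZMod 2) ≠ 1 := by decide
    ext (v | v)
    · have : Sum.inl v ∉ B := fun h => h10 (h1 _ h)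
      simp [this, odd]
    · constructor
      · intro h
        have hmem := hB h
        simp only [S, Finset.mem_erase, Finset.inr_mem_disjSum] at hmem
        simpa [odd] using hmem
      · intro h
        by_contra hvB
        refine h01 (h2 (Sum.inr v) ?_ hvB)
        simpa [S, odd] using h
  refine ⟨?_, fun hne => ?_⟩
  · let J := (S ×ˢ posWords K N).image fun x => (x.1, odd.erase x.1, x.2)
    refine (finrank_le_card_triples hK hN hS X hE J ?_).2.trans ?_
    · intro i hi B hB p hp _ h1 h2
      rw [hforced i hi B hB h1 h2]
      exact Finset.mem_image.mpr ⟨(i, posWord K N p),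
        Finset.mem_product.mpr ⟨hi, mem_posWords.mpr ⟨p, hp, rfl⟩⟩, rfl⟩
    · refine Finset.card_image_le.trans ?_
      rw [Finset.card_product, hS]
  · by_contra hcon
    refine hne (Nat.le_zero.mp ((finrank_le_card_triples hK hN hS X hE ∅ ?_).2.trans (by simp)))
    intro i hi B hB p hp hcard h1 h2
    refine absurd ⟨p, hp, ?_⟩ hcon
    have hodd : odd.card = l := by simp [odd]
    rw [hforced i hi B hB h1 h2] at hcard
    by_cases hi' : i ∈ odd
    · have := Finset.card_pos.mpr ⟨i, hi'⟩
      rw [Finset.card_erase_of_mem hi'] at hcard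
      exact ⟨1, le_rfl, by omega⟩
    · rw [Finset.erase_eq_of_notMem hi'] at hcard
      exact ⟨0, by omega, by omega⟩

lemma gradedCodim_le (hK : ∀ i, 0 < K i) (h_internal : DirectSum.IsInternal 𝒜)
    (h_mul : SetLike.GradedMul 𝒜)
    (ha : a F K ∈ 𝒜 0) (hz : z F K 0 0 ∈ 𝒜 0) (hb : b F K ∈ 𝒜 1) {N : ℕ} (hN : 1 ≤ N) {M : ℕ}
    (hM : ∀ p : ℕ × ℕ, p.2 < K p.1 → ∀ e ≤ 1, (N + 1).choose (bCount K p N + e) ≤ M) :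
    gradedCodim 𝒜 (N + 1) ≤ (N + 2) ^ 2 * (posWords K N).card * M := by
  have hterm : ∀ k ∈ Finset.range (N + 1 + 1), (N + 1).choose k * partialCodim 𝒜 k (N + 1 - k) ≤
      M * ((N + 1) * (posWords K N).card) := by
    intro k hk
    have hk' : k ≤ N + 1 := Nat.lt_succ_iff.mp (Finset.mem_range.mp hk)
    obtain ⟨h1, h2⟩ := partialCodim_le hK h_internal h_mul ha hz hb hN
      (show k + (N + 1 - k) = N + 1 by omega)
    by_cases h0 : partialCodim 𝒜 k (N + 1 - k) = 0
    · rw [h0, Nat.mul_zero]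
      exact Nat.zero_le _
    · obtain ⟨p, hp, e, he, hpe⟩ := h2 h0
      refine Nat.mul_le_mul ?_ h1
      rw [← Nat.choose_symm hk', hpe]
      exact hM p hp e he
  refine (Finset.sum_le_card_nsmul _ _ _ hterm).trans ?_
  rw [Finset.card_range, smul_eq_mul]
  calc (N + 1 + 1) * (M * ((N + 1) * (posWords K N).card))
      = (N + 2) * (N + 1) * ((posWords K N).card * M) := by ring
    _ ≤ (N + 2) * (N + 2) * ((posWords K N).card * M) := by gcongr; omega
    _ = (N + 2) ^ 2 * (posWords K N).card * M := by ring

lemma choose_le_gradedCodim (hK : ∀ i, 0 < K i)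
    (ha : a F K ∈ 𝒜 0) (hz : z F K 0 0 ∈ 𝒜 0) (hb : b F K ∈ 𝒜 1) {N : ℕ} (hN : 1 ≤ N) :
    N.choose (bCount K (0, 0) N) ≤ gradedCodim 𝒜 (N + 1) := by
  set l := bCount K (0, 0) N with hl
  have hlN : l ≤ N := bCount_le _ _
  let S : Finset (ℕ ⊕ ℕ) := (Finset.range (N + 1 - l)).disjSum (Finset.range l)
  let odd : Finset (ℕ ⊕ ℕ) := (Finset.range l).map Function.Embedding.inr
  have hS : S.card = N + 1 := by
    simp only [S, Finset.card_disjSum, Finset.card_range]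
    omega
  have hpos : 1 ≤ partialCodim 𝒜 (N + 1 - l) l := by
    have h := card_le_finrank (F := F) hK hN hS
      (E := {φ | (∀ i, φ (Sum.inl i) ∈ 𝒜 0) ∧ (∀ i, φ (Sum.inr i) ∈ 𝒜 1)})
      (i := Sum.inl 0) (by simp [S]; omega) (ζ := WordBasis.z 0 ⟨0, hK 0⟩) rfl {odd} ?_ ?_ ?_
    · exact h
    · simp only [Finset.mem_singleton, forall_eq]
      rintro (v | v) hv
      · simp [odd] at hv
      · simpa [S, odd] using hv
    · simp only [Finset.mem_singleton, forall_eq, odd, Finset.card_map, Finset.card_range]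
      exact hl
    · simp only [Finset.mem_singleton, forall_eq]
      refine ⟨Sum.elim (fun j => if j = 0 then z F K 0 0 else a F K) fun _ => b F K,
        ⟨fun j => ?_, fun j => hb⟩, ?_⟩
      · simp only [Sum.elim_inl]
        split_ifs
        · exact hz
        · exact ha
      · rintro (v | v) hv
        · by_cases h0 : v = 0
          · subst h0
            simp [stdSubst, z, hK 0]
          · simp [stdSubst, h0, odd, a]
        · have hv' : v < l := by simpa [S] using hv
          simp [stdSubst, odd, hv', b]
  have hmem : N + 1 - l ∈ Finset.range (N + 1 + 1) := Finset.mem_range.mpr (by omega)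
  refine le_trans ?_ (Finset.single_le_sum (f := fun k => (N + 1).choose k *
    partialCodim 𝒜 k (N + 1 - k)) (fun _ _ => Nat.zero_le _) hmem)
  rw [Nat.choose_symm (show l ≤ N + 1 by omega), show N + 1 - (N + 1 - l) = l by omega]
  calc N.choose l ≤ (N + 1).choose l := Nat.choose_le_succ N l
    _ ≤ (N + 1).choose l * partialCodim 𝒜 (N + 1 - l) l := Nat.le_mul_of_pos_right _ hpos

end Graded

end WordAlgebra

/-- A sequence bounded below by the binomial coefficients given by the prefixes, and above, up to
polynomial factors, by those given by all factors read along the chain. -/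
lemma tendsto_rpow_of_bCount_bounds {m : ℕ} (hm : 2 ≤ m) {w : ℕ → Fin 2}
    (hw : IsPeriodicWord w ∨ IsSturmian w) {α : ℝ} (hα : HasSlope w α) {c : ℕ → ℕ}
    (hlow : ∀ N, 1 ≤ N → N.choose (bCount (wordSeq m w) (0, 0) N) ≤ c (N + 1))
    (hup : ∀ N, 1 ≤ N → ∀ M, (∀ p : ℕ × ℕ, p.2 < wordSeq m w p.1 → ∀ e ≤ 1,
      (N + 1).choose (bCount (wordSeq m w) p N + e) ≤ M) →
        c (N + 1) ≤ (N + 2) ^ 2 * (posWords (wordSeq m w) N).card * M) :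
    Tendsto (fun n : ℕ => (c n : ℝ) ^ (1 / (n : ℝ))) atTop
      (𝓝 (entropyPhi (1 / ((m : ℝ) + α)))) := by
  classical
  obtain ⟨C, hC, hcomp⟩ := exists_uniform_bound hw
  have hα0 := hα.nonneg
  have hm' : (2 : ℝ) ≤ m := by exact_mod_cast hm
  have hden : 0 < (m : ℝ) + α := by linarith
  have hβ0 : 0 < 1 / ((m : ℝ) + α) := by positivity
  have hβ1 : 1 / ((m : ℝ) + α) < 1 := by
    rw [div_lt_one hden]
    linarith
  have h00 : ((0, 0) : ℕ × ℕ).2 < wordSeq m w ((0, 0) : ℕ × ℕ).1 := wordSeq_pos hm 0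
  have hunif := fun ε (hε : 0 < ε) => bCount_uniform hm hα hC (ε := ε) hε
  refine tendsto_rpow_of_choose_bounds hβ0 hβ1 (D := (m + 1) * C)
    (s := fun n => bCount (wordSeq m w) (0, 0) n) (fun n => bCount_le _ _) ?_ hlow ?_
  · rw [Metric.tendsto_atTop]
    intro ε hε
    obtain ⟨N, hN⟩ := hunif (ε / 2) (by positivity)
    refine ⟨max N 1, fun n hn => ?_⟩
    have h1 := hN n (le_of_max_le_left hn) (0, 0) h00
    have hn0 : (0 : ℝ) < n := by exact_mod_cast le_of_max_le_right hn
    rw [Real.dist_eq]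
    have h2 : (bCount (wordSeq m w) (0, 0) n : ℝ) / n - 1 / (m + α) =
        (bCount (wordSeq m w) (0, 0) n - 1 / (m + α) * n) / n := by
      field_simp
    rw [h2, abs_div, abs_of_pos hn0, div_lt_iff₀ hn0]
    nlinarith
  · intro ε hε
    obtain ⟨N₀, hN₀⟩ := hunif (ε / 2) (by positivity)
    obtain ⟨N₁, hN₁⟩ := exists_nat_ge (2 / (ε / 2))
    filter_upwards [eventually_ge_atTop (N₀ + N₁ + 2)] with n hn
    obtain ⟨N, rfl⟩ : ∃ N, n = N + 1 := ⟨n - 1, by omega⟩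
    -- a factor (and a shift `e`) for which the binomial coefficient is largest
    let R := (Finset.range (N + 1 + 1)).filter fun r => ∃ p : ℕ × ℕ, p.2 < wordSeq m w p.1 ∧
      ∃ e ≤ 1, r = bCount (wordSeq m w) p N + e
    have hmemR : ∀ p : ℕ × ℕ, p.2 < wordSeq m w p.1 → ∀ e ≤ 1,
        bCount (wordSeq m w) p N + e ∈ R := by
      intro p hp e he
      have := bCount_le (K := wordSeq m w) p N
      exact Finset.mem_filter.mpr ⟨Finset.mem_range.mpr (by omega), p, hp, e, he, rfl⟩
    obtain ⟨r, hr, hmax⟩ := Finset.exists_max_image R (fun r => (N + 1).choose r)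
      ⟨_, hmemR (0, 0) h00 0 (by omega)⟩
    obtain ⟨hr1, p, hp, e, he, hre⟩ := Finset.mem_filter.mp hr
    refine ⟨(N + 1).choose r, ?_, r, Nat.lt_succ_iff.mp (Finset.mem_range.mp hr1), ?_, rfl⟩
    · refine (hup N (by omega) _ fun p hp e he => hmax _ (hmemR p hp e he)).trans ?_
      have h1 : (posWords (wordSeq m w) N).card ≤ (m + 1) * C * (N + 2) := by
        refine (card_posWords_le N).trans ?_
        rw [Nat.mul_assoc]
        exact Nat.mul_le_mul_left _ ((hcomp N (by omega)).trans
          (Nat.mul_le_mul_left _ (by omega)))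
      calc (N + 2) ^ 2 * (posWords (wordSeq m w) N).card * (N + 1).choose r
          ≤ (N + 2) ^ 2 * ((m + 1) * C * (N + 2)) * (N + 1).choose r := by gcongr
        _ = (m + 1) * C * (N + 1 + 1) ^ 3 * (N + 1).choose r := by ring
    · have h1 := abs_le.mp (hN₀ N (by omega) p hp)
      have he' : (e : ℝ) ≤ 1 := by exact_mod_cast he
      have he0 : (0 : ℝ) ≤ e := Nat.cast_nonneg e
      have hNN : (N₁ : ℝ) ≤ N := by exact_mod_cast (show N₁ ≤ N by omega)
      have hbig : 2 ≤ ε / 2 * N := by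
        rw [div_le_iff₀ (by positivity)] at hN₁
        nlinarith
      rw [hre, abs_le]
      push_cast
      constructor <;> nlinarith [h1.1, h1.2]

end Exponents

theorem theorem3 (F : Type*) [Field F] [CharZero F] (m : ℕ) (hm : 2 ≤ m)
    (w : ℕ → Fin 2) (hw : IsPeriodicWord w ∨ IsSturmian w) (α : ℝ) (hα : HasSlope w α)
    (𝒜 : ZMod 2 → Submodule F (WordAlgebra F (wordSeq m w)))
    (h_internal : DirectSum.IsInternal 𝒜) (h_mul : SetLike.GradedMul 𝒜)
    (ha : WordAlgebra.a F (wordSeq m w) ∈ 𝒜 0)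
    (hz : WordAlgebra.z F (wordSeq m w) 0 0 ∈ 𝒜 0)
    (hb : WordAlgebra.b F (wordSeq m w) ∈ 𝒜 1) :
    HasGradedPIExponent 𝒜 (entropyPhi (1 / ((m : ℝ) + α))) ∧
      HasPIExponent F (WordAlgebra F (wordSeq m w)) (entropyPhi (1 / ((m : ℝ) + α))) := by
  
  have hK := wordSeq_pos (w := w) hm
  constructor
  · exact tendsto_rpow_of_bCount_bounds hm hw hα
      (fun N hN => WordAlgebra.choose_le_gradedCodim hK ha hz hb hN)
      fun N hN M hM => WordAlgebra.gradedCodim_le hK h_internal h_mul ha hz hb hN hM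
  · refine tendsto_rpow_of_bCount_bounds hm hw hα
      (fun N hN => WordAlgebra.choose_le_codim hK hN) fun N hN M hM => ?_
    refine (WordAlgebra.codim_le hK hN fun p hp =>
      (Nat.choose_le_succ N _).trans (hM p hp 0 zero_le_one)).trans ?_
    gcongr
    nlinarith
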